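/- Let $n \ge 2$ and let $B(0,1)$ be the open unit ball of $\mathbf{R}^n$. There exists a continuous matrix field $A \in C(B(0,1); \mathbf{R}^{n\times n})$ which is elliptic, that is, $A(x)$ is symmetric for every $x \in B(0,1)$ and there are constants $\lambda, \Lambda > 0$ such that $$\lambda |\xi|^2 \le (A(x)\xi)\cdot \xi \le \Lambda |\xi|^2 \qquad \text{for all } x \in B(0,1),\ \xi \in \mathbf{R}^n,$$ such that the Dirichlet problem $$-\operatorname{div}(A\nabla u) = 0 \ \text{ in } B(0,1), \qquad u = 0 \ \text{ on } \partial B(0,1),$$ has a nontrivial weak solution in $W^{1,1}$: there is a function $u \in W^{1,1}_0(B(0,1))$ (the closure of $C_c^\infty(B(0,1))$ in $W^{1,1}(B(0,1))$) which is not equal to $0$ almost everywhere in $B(0,1)$ and satisfies $$\int_{B(0,1)} (A\nabla u)\cdot\nabla\varphi = 0 \qquad \text{for every } \varphi \in C^1_c(B(0,1)).$$ -/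

import Mathlib

open MeasureTheory Set Filter Topology
open scoped Gradient Matrix

/-- `φ` belongs to `C^k_c(Ω)`: it is of class `C^k` and its support is a compact subset
of `Ω`. -/
def IsTestFunction {n : ℕ} (Ω : Set (EuclideanSpace ℝ (Fin n))) (k : ℕ∞)
    (φ : EuclideanSpace ℝ (Fin n) → ℝ) : Prop :=
  ContDiff ℝ k φ ∧ HasCompactSupport φ ∧ tsupport φ ⊆ Ω

/-- `u` and `G` are locally integrable on the open set `Ω` and `G` is the gradient of `u` in the
sense of distributions on `Ω`. So `u ∈ W^{1,1}_loc(Ω)` means that such a `G` exists; it is then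
unique almost everywhere on `Ω`. -/
structure HasWeakGradient {n : ℕ} (Ω : Set (EuclideanSpace ℝ (Fin n)))
    (u : EuclideanSpace ℝ (Fin n) → ℝ)
    (G : EuclideanSpace ℝ (Fin n) → EuclideanSpace ℝ (Fin n)) : Prop where
  locallyIntegrableOn : LocallyIntegrableOn u Ω
  locallyIntegrableOn_grad : LocallyIntegrableOn G Ω
  integral_eq : ∀ φ : EuclideanSpace ℝ (Fin n) → ℝ, IsTestFunction Ω ⊤ φ →
    ∀ i : Fin n, ∫ x in Ω, u x * (∇ φ x) i = -∫ x in Ω, (G x) i * φ x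

/-- `u ∈ W^{1,1}_0(Ω)`: `u ∈ W^{1,1}(Ω)` is a limit of functions of class `C^∞_c(Ω)` in the
norm `‖u‖_{L¹(Ω)} + ‖∇u‖_{L¹(Ω)}`. -/
def MemW11Zero {n : ℕ} (Ω : Set (EuclideanSpace ℝ (Fin n)))
    (u : EuclideanSpace ℝ (Fin n) → ℝ) : Prop :=
  ∃ G : EuclideanSpace ℝ (Fin n) → EuclideanSpace ℝ (Fin n),
    HasWeakGradient Ω u G ∧ IntegrableOn u Ω ∧ IntegrableOn G Ω ∧
    ∃ φ : ℕ → EuclideanSpace ℝ (Fin n) → ℝ, (∀ k, IsTestFunction Ω ⊤ (φ k)) ∧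
      Tendsto (fun k => ∫ x in Ω, |φ k x - u x|) atTop (𝓝 0) ∧
      Tendsto (fun k => ∫ x in Ω, ‖∇ (φ k) x - G x‖) atTop (𝓝 0)

/-- The matrix field `A` is elliptic on `Ω`: it is symmetric, bounded and uniformly positive
definite there. -/
def IsElliptic {n : ℕ} (Ω : Set (EuclideanSpace ℝ (Fin n)))
    (A : EuclideanSpace ℝ (Fin n) → Matrix (Fin n) (Fin n) ℝ) : Prop :=
  ∃ l L : ℝ, 0 < l ∧ 0 < L ∧ ∀ x ∈ Ω, (A x).IsSymm ∧ ∀ ξ : EuclideanSpace ℝ (Fin n),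
    l * ‖ξ‖ ^ 2 ≤ (A x *ᵥ ξ.ofLp) ⬝ᵥ ξ.ofLp ∧ (A x *ᵥ ξ.ofLp) ⬝ᵥ ξ.ofLp ≤ L * ‖ξ‖ ^ 2

/-- `u ∈ W^{1,1}_loc(Ω)` is a weak solution of `-div (A ∇u) = 0` in `Ω`. -/
def IsWeakSolution {n : ℕ} (Ω : Set (EuclideanSpace ℝ (Fin n)))
    (A : EuclideanSpace ℝ (Fin n) → Matrix (Fin n) (Fin n) ℝ)
    (u : EuclideanSpace ℝ (Fin n) → ℝ) : Prop :=
  ∃ G : EuclideanSpace ℝ (Fin n) → EuclideanSpace ℝ (Fin n), HasWeakGradient Ω u G ∧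
    ∀ φ : EuclideanSpace ℝ (Fin n) → ℝ, IsTestFunction Ω 1 φ →
      ∫ x in Ω, (A x *ᵥ (G x).ofLp) ⬝ᵥ (∇ φ x).ofLp = 0

/-! The starting point is h(x) = xᵢ(‖x‖⁻ⁿ - 1), which is harmonic off the origin and zero on the
unit sphere. Its gradient is of size ‖x‖⁻ⁿ, which just fails to be integrable. Damping by a
logarithm cures this: with s = ‖x‖², w = 1 / (64 + log² s) and u = w h, the gradient is at most a
multiple of w ‖x‖⁻ⁿ (`majorant`), and ∫ dr / (r log² r) converges at 0.

The matrix is then fitted to u. Take A with one eigenvalue along x and one on the orthogonal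
complement. The radial component of A∇u is prescribed to be w times that of ∇h, so the derivative of
w is dropped. The equation div(A∇u) = 0 off the origin then forces the tangential component, which
is that of w∇h plus `tangentialFlux`. Dividing by the components of ∇u gives `radialCoeff` and
`tangentialCoeff`. Both differ from 1 by O(w |log s|) near 0, hence tend to 1 there, so A extends
continuously by the identity.

Two facts remain. First, u is in W₀^{1,1}: cutoffs away from both the origin and the sphere converge
by domination (`abs_solution_mul_le`), and the weak gradient comes from the same limit. Second, the
flux has no divergence concentrated at the origin (`integral_inner_flux_gradient`). Against φ - φ(0)
= O(‖x‖) the cutoff gradient, of size 1/‖x‖, is harmless because the flux is integrable; against the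
constant φ(0) the integral is zero, because the flux is even and the gradient of a radial cutoff is
odd. -/

/-! ### Radial profiles

All radial quantities are expressed as functions of `s = ‖x‖ ^ 2`. -/

namespace RadialProfile

/-- The logarithmic weight `1 / (64 + log² s)`. -/
noncomputable def logWeight (s : ℝ) : ℝ := (64 + Real.log s ^ 2)⁻¹

/-- The power `s ^ (-d / 2)`, which is `‖x‖ ^ (-d)` at `s = ‖x‖ ^ 2`. -/
noncomputable def invPow (d s : ℝ) : ℝ := Real.exp (-(d / 2) * Real.log s)

/-- The radial factor `k` of the solution `x₁ k(‖x‖²)`. -/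
noncomputable def profile (d s : ℝ) : ℝ := logWeight s * (invPow d s - 1)

/-- The derivative of `profile`. -/
noncomputable def profileDeriv (d s : ℝ) : ℝ :=
  -2 * Real.log s / s * logWeight s ^ 2 * (invPow d s - 1) - d / 2 * logWeight s * invPow d s / s

/-- The correction of the tangential flux due to the perturbation of the Laplacian. -/
noncomputable def tangentialFlux (d s : ℝ) : ℝ :=
  4 * Real.log s * logWeight s ^ 2 * ((d - 1) * invPow d s + 1) / (d - 1)

/-- The coefficient of `e₁` in the flux. -/
noncomputable def fluxConst (d s : ℝ) : ℝ := profile d s + tangentialFlux d s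

/-- The coefficient of `x₁ x` in the flux. -/
noncomputable def fluxQuad (d s : ℝ) : ℝ :=
  -(d * logWeight s * invPow d s + tangentialFlux d s) / s

/-- The eigenvalue of the coefficient matrix in the tangential directions. -/
noncomputable def tangentialCoeff (d s : ℝ) : ℝ :=
  1 + 4 * Real.log s * logWeight s * ((d - 1) * invPow d s + 1) / ((invPow d s - 1) * (d - 1))

/-- The eigenvalue of the coefficient matrix in the radial direction. -/
noncomputable def radialCoeff (d s : ℝ) : ℝ :=
  (1 + 4 * Real.log s * logWeight s * (invPow d s - 1) / ((d - 1) * invPow d s + 1))⁻¹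

/-- A bound for the deviation of the coefficients from `1`. -/
noncomputable def coeffModulus (s : ℝ) : ℝ := (8 - 4 * Real.log s) * logWeight s

/-! ### Elementary bounds for the weight and the power. -/

lemma logWeight_denom_pos (s : ℝ) : 0 < 64 + Real.log s ^ 2 := by positivity

lemma logWeight_pos (s : ℝ) : 0 < logWeight s := inv_pos.2 (logWeight_denom_pos s)

lemma logWeight_le (s : ℝ) : logWeight s ≤ 1 / 64 := by
  rw [logWeight, one_div]
  exact inv_anti₀ (by norm_num) (by nlinarith [sq_nonneg (Real.log s)])

/-- The constant 64 = 8² is chosen here: 16|log s| ≤ 64 + log² s is the square (|log s| - 8)² ≥ 0.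
It makes the perturbation of the Laplacian small on the whole ball, not only near the origin. -/
lemma abs_log_mul_logWeight_le (s : ℝ) : 4 * |Real.log s| * logWeight s ≤ 1 / 4 := by
  rw [logWeight, ← div_eq_mul_inv, div_le_iff₀ (logWeight_denom_pos s), ← sq_abs (Real.log s)]
  nlinarith [sq_nonneg (|Real.log s| - 8)]

lemma invPow_pos (d s : ℝ) : 0 < invPow d s := Real.exp_pos _

lemma invPow_sub_one_ge {d s : ℝ} : d / 2 * -Real.log s ≤ invPow d s - 1 := by
  have := Real.add_one_le_exp (-(d / 2) * Real.log s)
  rw [invPow]; linarith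

lemma one_lt_invPow {d s : ℝ} (hd : 2 ≤ d) (hs : 0 < s) (hs1 : s < 1) : 1 < invPow d s := by
  have := Real.log_neg hs hs1
  exact Real.one_lt_exp_iff.2 (by nlinarith)

/-- Bernoulli's inequality for s ^ (d / 2), multiplied by `invPow d s`. The factor 1 - s records the
linear vanishing of the solution at the sphere. -/
lemma invPow_sub_one_le {d s : ℝ} (hd : 2 ≤ d) (hs : 0 < s) :
    invPow d s - 1 ≤ d / 2 * (1 - s) * invPow d s := by
  have h1 := one_add_mul_self_le_rpow_one_add (s := s - 1) (by linarith) (p := d / 2) (by linarith)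
  have h2 : (1 + (s - 1)) ^ (d / 2) * invPow d s = 1 := by
    rw [add_sub_cancel, Real.rpow_def_of_pos hs, invPow, ← Real.exp_add]
    simp; ring
  have h3 := mul_le_mul_of_nonneg_right h1 (invPow_pos d s).le
  nlinarith

/-! ### Derivatives and regularity of the profiles. -/

lemma hasDerivAt_logWeight {s : ℝ} (hs : 0 < s) :
    HasDerivAt logWeight (-2 * Real.log s / s * logWeight s ^ 2) s := by
  have h := (((Real.hasDerivAt_log hs.ne').pow 2).const_add 64).inv (logWeight_denom_pos s).ne'
  refine h.congr_deriv ?_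
  have := (logWeight_denom_pos s).ne'
  simp only [logWeight]
  field_simp
  simp only [Pi.pow_apply, Nat.cast_ofNat, Nat.add_one_sub_one, pow_one]
  rw [mul_div_assoc, div_self (pow_ne_zero 2 this), mul_one]

lemma hasDerivAt_invPow (d : ℝ) {s : ℝ} (hs : 0 < s) :
    HasDerivAt (invPow d) (-(d / 2) * invPow d s / s) s := by
  have h := ((Real.hasDerivAt_log hs.ne').const_mul (-(d / 2))).exp
  refine h.congr_deriv ?_
  simp only [invPow]
  field_simp

lemma hasDerivAt_profile (d : ℝ) {s : ℝ} (hs : 0 < s) :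
    HasDerivAt (profile d) (profileDeriv d s) s := by
  refine ((hasDerivAt_logWeight hs).mul ((hasDerivAt_invPow d hs).sub_const 1)).congr_deriv ?_
  rw [profileDeriv]; ring

lemma hasDerivAt_tangentialFlux (d : ℝ) {s : ℝ} (hs : 0 < s) :
    HasDerivAt (tangentialFlux d)
      ((4 / s * logWeight s ^ 2 * ((d - 1) * invPow d s + 1)
        - 16 * Real.log s ^ 2 / s * logWeight s ^ 3 * ((d - 1) * invPow d s + 1)
        - 4 * Real.log s * logWeight s ^ 2 * (d - 1) * (d / 2) * invPow d s / s) / (d - 1)) s := by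
  have h := (((((Real.hasDerivAt_log hs.ne').const_mul 4).mul
    ((hasDerivAt_logWeight hs).pow 2)).mul
    (((hasDerivAt_invPow d hs).const_mul (d - 1)).add_const 1))).div_const (d - 1)
  refine h.congr_deriv ?_
  simp
  ring

/-- The radial form of the equation `div V = 0` for `V x = α(‖x‖²) e₁ + β(‖x‖²) x₁ x`. -/
lemma exists_hasDerivAt_flux {d s : ℝ} (hd : 2 ≤ d) (hs : 0 < s) :
    ∃ α' β' : ℝ, HasDerivAt (fluxConst d) α' s ∧ HasDerivAt (fluxQuad d) β' s ∧
      2 * α' + 2 * s * β' + (d + 1) * fluxQuad d s = 0 := by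
  have hψ := hasDerivAt_tangentialFlux d hs
  refine ⟨_, _, (hasDerivAt_profile d hs).add hψ,
    (((((hasDerivAt_logWeight hs).const_mul d).mul (hasDerivAt_invPow d hs)).add
      hψ).neg).div (hasDerivAt_id s) hs.ne', ?_⟩
  have hd1 : d - 1 ≠ 0 := by linarith
  have hw : logWeight s = (64 + Real.log s ^ 2)⁻¹ := rfl
  -- The derivative of `tangentialFlux` enters 2α' and 2sβ' with opposite signs and cancels. What is
  -- left is linear in `tangentialFlux` itself and is solved by its definition.
  simp only [profileDeriv, fluxQuad, tangentialFlux, Pi.neg_apply, Pi.add_apply, Pi.mul_apply]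
  generalize logWeight s = w at *
  generalize invPow d s = p
  generalize Real.log s = l at *
  field_simp
  ring

lemma contDiffAt_logWeight {m : WithTop ℕ∞} {s : ℝ} (hs : 0 < s) : ContDiffAt ℝ m logWeight s :=
  (contDiffAt_const.add ((Real.contDiffAt_log.2 hs.ne').pow 2)).inv (logWeight_denom_pos s).ne'

lemma contDiffAt_invPow {m : WithTop ℕ∞} (d : ℝ) {s : ℝ} (hs : 0 < s) :
    ContDiffAt ℝ m (invPow d) s :=
  (contDiffAt_const.mul (Real.contDiffAt_log.2 hs.ne')).exp

lemma contDiffAt_profile {m : WithTop ℕ∞} (d : ℝ) {s : ℝ} (hs : 0 < s) :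
    ContDiffAt ℝ m (profile d) s :=
  (contDiffAt_logWeight hs).mul ((contDiffAt_invPow d hs).sub contDiffAt_const)

lemma contDiffAt_tangentialFlux {m : WithTop ℕ∞} (d : ℝ) {s : ℝ} (hs : 0 < s) :
    ContDiffAt ℝ m (tangentialFlux d) s :=
  (((contDiffAt_const.mul (Real.contDiffAt_log.2 hs.ne')).mul
    ((contDiffAt_logWeight hs).pow 2)).mul
    ((contDiffAt_const.mul (contDiffAt_invPow d hs)).add contDiffAt_const)).div_const _

lemma contDiffAt_fluxConst {m : WithTop ℕ∞} (d : ℝ) {s : ℝ} (hs : 0 < s) :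
    ContDiffAt ℝ m (fluxConst d) s :=
  (contDiffAt_profile d hs).add (contDiffAt_tangentialFlux d hs)

lemma contDiffAt_fluxQuad {m : WithTop ℕ∞} (d : ℝ) {s : ℝ} (hs : 0 < s) :
    ContDiffAt ℝ m (fluxQuad d) s :=
  (((contDiffAt_const.mul (contDiffAt_logWeight hs)).mul (contDiffAt_invPow d hs)).add
    (contDiffAt_tangentialFlux d hs)).neg.div contDiffAt_id hs.ne'

/-! ### The two eigenvalues: continuity, bounds, and limit at the origin. -/

lemma continuousAt_tangentialCoeff {d s : ℝ} (hd : 2 ≤ d) (hs : 0 < s) (hs1 : s < 1) :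
    ContinuousAt (tangentialCoeff d) s := by
  have hp := one_lt_invPow hd hs hs1
  have hl : ContinuousAt Real.log s := Real.continuousAt_log hs.ne'
  have hw : ContinuousAt logWeight s := (contDiffAt_logWeight (m := 0) hs).continuousAt
  have hP : ContinuousAt (invPow d) s := (contDiffAt_invPow (m := 0) d hs).continuousAt
  refine continuousAt_const.add (ContinuousAt.div (by fun_prop) (by fun_prop) ?_)
  exact (mul_pos (by linarith) (by linarith)).ne'

/-- With p = `invPow d s`, the numerator (d - 1)p + 1 equals (d - 1)(p - 1) + d. The first part
gives the term -4 log s of `coeffModulus`. The second gives the 8, since p - 1 ≥ (d / 2)(-log s)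
absorbs the logarithm; this also controls the quotient as s → 1, where p - 1 vanishes. -/
lemma tangentialCoeff_bounds {d s : ℝ} (hd : 2 ≤ d) (hs : 0 < s) (hs1 : s < 1) :
    0 ≤ 1 - tangentialCoeff d s ∧ 1 - tangentialCoeff d s ≤ coeffModulus s := by
  have hl := Real.log_neg hs hs1
  have hp := one_lt_invPow hd hs hs1
  have hp2 := invPow_sub_one_ge (d := d) (s := s)
  have hw := logWeight_pos s
  simp only [tangentialCoeff, coeffModulus]
  generalize logWeight s = w at *
  generalize invPow d s = p at *
  generalize Real.log s = l at *
  have hden : 0 < (p - 1) * (d - 1) := mul_pos (by linarith) (by linarith)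
  have e : 1 - (1 + 4 * l * w * ((d - 1) * p + 1) / ((p - 1) * (d - 1)))
      = 4 * -l * w * ((d - 1) * p + 1) / ((p - 1) * (d - 1)) := by ring
  rw [e]
  have hnum : 0 < (d - 1) * p + 1 := by nlinarith
  refine ⟨div_nonneg (mul_nonneg (mul_nonneg (by linarith) hw.le) hnum.le) hden.le, ?_⟩
  rw [div_le_iff₀ hden]
  have h1 : 4 * -l * ((d - 1) * p + 1) ≤ (8 - 4 * l) * ((p - 1) * (d - 1)) := by
    nlinarith [mul_le_mul_of_nonneg_right hp2 (show 0 ≤ d - 1 by linarith),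
      mul_nonneg (show 0 ≤ d - 2 by linarith) (show 0 ≤ -l by linarith),
      mul_nonneg (mul_nonneg (show 0 ≤ d - 2 by linarith) (show 0 ≤ -l by linarith))
        (show 0 ≤ d by linarith)]
  nlinarith [mul_le_mul_of_nonneg_right h1 hw.le]

/-- The bound is 8/64 + 1/4. Being below 1/2, it keeps the denominator of `radialCoeff` above 1/2.
-/
lemma coeffModulus_le {s : ℝ} (hs : 0 < s) (hs1 : s < 1) : coeffModulus s ≤ 3 / 8 := by
  have h1 := abs_log_mul_logWeight_le s
  have h2 := logWeight_le s
  rw [abs_of_neg (Real.log_neg hs hs1)] at h1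
  rw [coeffModulus]
  linarith

lemma radialCoeff_aux {d s : ℝ} (hd : 2 ≤ d) (hs : 0 < s) (hs1 : s < 1) :
    -(coeffModulus s) ≤
      4 * Real.log s * logWeight s * (invPow d s - 1) / ((d - 1) * invPow d s + 1) ∧
    4 * Real.log s * logWeight s * (invPow d s - 1) / ((d - 1) * invPow d s + 1) ≤ 0 := by
  have hl := Real.log_neg hs hs1
  have hp := one_lt_invPow hd hs hs1
  have hw := logWeight_pos s
  simp only [coeffModulus]
  generalize logWeight s = w at *
  generalize invPow d s = p at *
  generalize Real.log s = l at *
  have hnum : 0 < (d - 1) * p + 1 := by nlinarith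
  have hlw : 0 < -l * w := mul_pos (by linarith) hw
  constructor
  · rw [le_div_iff₀ hnum]
    have : p - 1 ≤ (d - 1) * p + 1 := by nlinarith
    nlinarith [mul_le_mul_of_nonneg_left this hlw.le, mul_pos hw hnum]
  · exact div_nonpos_of_nonpos_of_nonneg (by nlinarith) hnum.le

lemma radialCoeff_denom_pos {d s : ℝ} (hd : 2 ≤ d) (hs : 0 < s) (hs1 : s < 1) :
    0 < 1 + 4 * Real.log s * logWeight s * (invPow d s - 1) / ((d - 1) * invPow d s + 1) := by
  linarith [(radialCoeff_aux hd hs hs1).1, coeffModulus_le hs hs1]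

lemma continuousAt_radialCoeff {d s : ℝ} (hd : 2 ≤ d) (hs : 0 < s) (hs1 : s < 1) :
    ContinuousAt (radialCoeff d) s := by
  have hp := one_lt_invPow hd hs hs1
  have hl : ContinuousAt Real.log s := Real.continuousAt_log hs.ne'
  have hw : ContinuousAt logWeight s := (contDiffAt_logWeight (m := 0) hs).continuousAt
  have hP : ContinuousAt (invPow d) s := (contDiffAt_invPow (m := 0) d hs).continuousAt
  refine ContinuousAt.inv₀ (continuousAt_const.add
    (ContinuousAt.div (by fun_prop) (by fun_prop) ?_)) (radialCoeff_denom_pos hd hs hs1).ne'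
  nlinarith

lemma radialCoeff_bounds {d s : ℝ} (hd : 2 ≤ d) (hs : 0 < s) (hs1 : s < 1) :
    0 ≤ radialCoeff d s - 1 ∧ radialCoeff d s - 1 ≤ 2 * coeffModulus s := by
  obtain ⟨h1, h2⟩ := radialCoeff_aux hd hs hs1
  have h3 := coeffModulus_le hs hs1
  rw [radialCoeff]
  generalize 4 * Real.log s * logWeight s * (invPow d s - 1) / ((d - 1) * invPow d s + 1) = y at *
  generalize coeffModulus s = ω at *
  have hy : 0 < 1 + y := by linarith
  have e : (1 + y)⁻¹ - 1 = -y / (1 + y) := by field_simp; ring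
  rw [e]
  refine ⟨div_nonneg (by linarith) hy.le, ?_⟩
  rw [div_le_iff₀ hy]
  -- Since -y ≤ ω and 1 + y ≥ 5/8, the quotient -y / (1 + y) is at most 2ω.
  nlinarith

lemma tendsto_coeffModulus : Tendsto coeffModulus (𝓝[>] 0) (𝓝 0) := by
  have h : Tendsto (fun l : ℝ => (8 - 4 * l) * (64 + l ^ 2)⁻¹) atBot (𝓝 0) := by
    have hinv : Tendsto (fun l : ℝ => l⁻¹) atBot (𝓝 0) := tendsto_inv_atBot_zero
    have h2 : Tendsto (fun l : ℝ => (8 * l⁻¹ - 4) * l⁻¹ * (64 * (l⁻¹ * l⁻¹) + 1)⁻¹) atBot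
        (𝓝 ((8 * 0 - 4) * 0 * (64 * (0 * 0) + 1)⁻¹)) :=
      (((hinv.const_mul 8).sub_const 4).mul hinv).mul
        ((((hinv.mul hinv).const_mul 64).add_const 1).inv₀ (by norm_num))
    rw [show ((8 * 0 - 4) * 0 * (64 * (0 * 0) + 1)⁻¹ : ℝ) = 0 by norm_num] at h2
    refine h2.congr' ?_
    filter_upwards [eventually_lt_atBot 0] with l hl
    have := hl.ne
    field_simp
  exact h.comp Real.tendsto_log_nhdsGT_zero

/-! ### The eigenvalues carry the gradient to the flux, component by component. -/

lemma tangentialCoeff_mul_profile {d s : ℝ} (hd : 2 ≤ d) (hs : 0 < s) (hs1 : s < 1) :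
    tangentialCoeff d s * profile d s = fluxConst d s := by
  have hp := one_lt_invPow hd hs hs1
  have h1 : invPow d s - 1 ≠ 0 := by linarith
  have h2 : d - 1 ≠ 0 := by linarith
  simp only [tangentialCoeff, fluxConst, profile, tangentialFlux]
  field_simp

/-- Both brackets are coefficients of xᵢ x in radial components, the vector eᵢ contributing xᵢ x /
s. The right side is -w((d - 1)p + 1) / s, the harmonic value times w; the left bracket has an
additional term from the derivative of w, and `radialCoeff` removes it. -/
lemma radialCoeff_mul {d s : ℝ} (hd : 2 ≤ d) (hs : 0 < s) (hs1 : s < 1) :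
    radialCoeff d s * (2 * profileDeriv d s + profile d s / s) = fluxQuad d s + fluxConst d s / s := by
  have hp := one_lt_invPow hd hs hs1
  have h3 := (radialCoeff_denom_pos hd hs hs1).ne'
  have hnum : (d - 1) * invPow d s + 1 ≠ 0 := by nlinarith
  rw [radialCoeff, inv_mul_eq_iff_eq_mul₀ h3]
  have hd1 : d - 1 ≠ 0 := by linarith
  simp only [profileDeriv, fluxConst, profile, fluxQuad, tangentialFlux]
  generalize hN : (d - 1) * invPow d s + 1 = N at *
  field_simp
  subst hN
  ring

/-! ### Size of the profiles relative to `logWeight s * invPow d s`. -/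

lemma profile_pos {d s : ℝ} (hd : 2 ≤ d) (hs : 0 < s) (hs1 : s < 1) : 0 < profile d s :=
  mul_pos (logWeight_pos s) (by linarith [one_lt_invPow hd hs hs1])

lemma profile_le (d s : ℝ) : profile d s ≤ logWeight s * invPow d s := by
  rw [profile]
  nlinarith [logWeight_pos s]

lemma profile_le_one_sub {d s : ℝ} (hd : 2 ≤ d) (hs : 0 < s) :
    profile d s ≤ d / 2 * (1 - s) * (logWeight s * invPow d s) := by
  rw [profile]
  nlinarith [mul_le_mul_of_nonneg_left (invPow_sub_one_le hd hs) (logWeight_pos s).le]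

lemma abs_profileDeriv_le {d s : ℝ} (hd : 2 ≤ d) (hs : 0 < s) (hs1 : s < 1) :
    |profileDeriv d s| * s ≤ d * (logWeight s * invPow d s) := by
  have hp := one_lt_invPow hd hs hs1
  have hw := logWeight_pos s
  have hl := Real.log_neg hs hs1
  have hm := abs_log_mul_logWeight_le s
  rw [abs_of_neg hl] at hm
  have e : profileDeriv d s * s =
      -2 * Real.log s * logWeight s ^ 2 * (invPow d s - 1) - d / 2 * logWeight s * invPow d s := by
    rw [profileDeriv]; field_simp
  rw [← abs_of_pos hs, ← abs_mul, abs_of_pos hs, e]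
  generalize logWeight s = w at *
  generalize invPow d s = p at *
  generalize Real.log s = l at *
  have hwp : 0 < w * p := mul_pos hw (by linarith)
  have h1 : 0 ≤ -l * w * (w * (p - 1)) :=
    mul_nonneg (mul_nonneg (by linarith) hw.le) (mul_nonneg hw.le (by linarith))
  have h2 : -l * w * (w * (p - 1)) ≤ 1 / 16 * (w * p) :=
    mul_le_mul (by linarith) (by nlinarith) (mul_nonneg hw.le (by linarith)) (by norm_num)
  rw [abs_le]
  constructor <;> nlinarith

lemma abs_fluxConst_le {d s : ℝ} (hd : 2 ≤ d) (hs : 0 < s) (hs1 : s < 1) :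
    |fluxConst d s| ≤ logWeight s * invPow d s := by
  have h1 := tangentialCoeff_bounds hd hs hs1
  have h2 := coeffModulus_le hs hs1
  have hk := profile_pos hd hs hs1
  rw [← tangentialCoeff_mul_profile hd hs hs1, abs_mul, abs_of_pos hk]
  refine le_trans ?_ (profile_le d s)
  refine mul_le_of_le_one_left hk.le ?_
  rw [abs_le]; constructor <;> linarith

lemma abs_fluxQuad_le {d s : ℝ} (hd : 2 ≤ d) (hs : 0 < s) (hs1 : s < 1) :
    |fluxQuad d s| * s ≤ (d + 2) * (logWeight s * invPow d s) := by
  have h1 := abs_fluxConst_le hd hs hs1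
  have h2 := profile_le d s
  have h3 := profile_pos hd hs hs1
  -- The correction `tangentialFlux` cancels in s β + α, so the bound on α = `fluxConst` suffices.
  have e : fluxQuad d s * s = -(d * (logWeight s * invPow d s)) + profile d s - fluxConst d s := by
    rw [fluxQuad, fluxConst]; field_simp; ring
  rw [← abs_of_pos hs, ← abs_mul, abs_of_pos hs, e]
  have hwp : 0 < logWeight s * invPow d s := mul_pos (logWeight_pos s) (invPow_pos d s)
  rw [abs_le] at h1 ⊢
  constructor <;> nlinarith

end RadialProfile

/-! ### Integrability of the radial majorant. -/

namespace RadialProfile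

/-- The radial majorant of the solution, its gradient and its flux. -/
noncomputable def majorant {n : ℕ} (x : EuclideanSpace ℝ (Fin n)) : ℝ :=
  logWeight (‖x‖ ^ 2) * invPow n (‖x‖ ^ 2)

lemma majorant_pos {n : ℕ} (x : EuclideanSpace ℝ (Fin n)) : 0 < majorant x :=
  mul_pos (logWeight_pos _) (invPow_pos _ _)

/-- The substitution r = exp y turns the integrand into 1 / (64 + 4y²), a rescaled Cauchy density.
The square of the logarithm is what makes the borderline singularity 1/r integrable. -/
lemma integrableOn_inv_mul_logWeight :
    IntegrableOn (fun r : ℝ => r⁻¹ * logWeight (r ^ 2)) (Ioi 0) := by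
  rw [← Real.range_exp, ← image_univ, integrableOn_image_iff_integrableOn_abs_deriv_smul
    MeasurableSet.univ (fun x _ => (Real.hasDerivAt_exp x).hasDerivWithinAt)
    Real.exp_injective.injOn, integrableOn_univ]
  have h := (integrable_inv_one_add_sq.comp_div (R := 4) (by norm_num)).div_const 64
  refine h.congr (Eventually.of_forall fun y => ?_)
  have h1 : Real.exp y ≠ 0 := (Real.exp_pos y).ne'
  have h2 : Real.log (Real.exp y ^ 2) = 2 * y := by rw [Real.log_pow, Real.log_exp]; norm_num
  simp only [logWeight, h2, abs_of_pos (Real.exp_pos y), smul_eq_mul]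
  field_simp
  norm_num
  ring

lemma integrable_majorant {n : ℕ} (hn : 2 ≤ n) :
    Integrable (majorant : EuclideanSpace ℝ (Fin n) → ℝ) := by
  have : Nontrivial (EuclideanSpace ℝ (Fin n)) := by
    have : Nonempty (Fin n) := ⟨⟨0, by omega⟩⟩
    infer_instance
  refine (integrable_fun_norm_addHaar volume
    (f := fun r : ℝ => logWeight (r ^ 2) * invPow n (r ^ 2))).2 ?_
  refine integrableOn_inv_mul_logWeight.congr_fun (fun r hr => ?_) measurableSet_Ioi
  have hr : 0 < r := hr
  -- The power r⁻ⁿ against the radial volume factor r ^ (n - 1) leaves exactly r⁻¹.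
  have h1 : invPow n (r ^ 2) = (r ^ n)⁻¹ := by
    rw [invPow, Real.log_pow, ← Real.exp_log (pow_pos hr n), ← Real.exp_neg, Real.log_pow]
    congr 1
    push_cast
    ring
  obtain ⟨m, rfl⟩ : ∃ m, n = m + 1 := ⟨n - 1, by omega⟩
  simp only [finrank_euclideanSpace, Fintype.card_fin, smul_eq_mul, h1, Nat.add_sub_cancel]
  field_simp
  ring

end RadialProfile

/-! ### Gradients and integration by parts -/

section Gradient

variable {F : Type*} [NormedAddCommGroup F] [InnerProductSpace ℝ F] [CompleteSpace F]

lemma HasGradientAt.mul_real {f g : F → ℝ} {f' g' x : F} (hf : HasGradientAt f f' x)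
    (hg : HasGradientAt g g' x) :
    HasGradientAt (fun y => f y * g y) (f x • g' + g x • f') x := by
  have h := hf.hasFDerivAt.mul hg.hasFDerivAt
  rw [hasGradientAt_iff_hasFDerivAt]
  refine h.congr_fderiv ?_
  simp

lemma HasDerivAt.comp_hasGradientAt {h : ℝ → ℝ} {h' : ℝ} {f : F → ℝ} {f' x : F}
    (hh : HasDerivAt h h' (f x)) (hf : HasGradientAt f f' x) :
    HasGradientAt (fun y => h (f y)) (h' • f') x := by
  have h := hh.comp_hasFDerivAt x hf.hasFDerivAt
  rw [hasGradientAt_iff_hasFDerivAt]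
  refine h.congr_fderiv ?_
  simp

lemma hasGradientAt_norm_sq (x : F) : HasGradientAt (fun y : F => ‖y‖ ^ 2) ((2 : ℝ) • x) x := by
  rw [hasGradientAt_iff_hasFDerivAt]
  refine (hasStrictFDerivAt_norm_sq x).hasFDerivAt.congr_fderiv ?_
  ext y
  simp

end Gradient

section Euclidean

variable {n : ℕ}

lemma hasGradientAt_coord (i : Fin n) (x : EuclideanSpace ℝ (Fin n)) :
    HasGradientAt (fun y : EuclideanSpace ℝ (Fin n) => y i) (EuclideanSpace.single i 1) x := by
  rw [hasGradientAt_iff_hasFDerivAt]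
  refine (EuclideanSpace.proj i : EuclideanSpace ℝ (Fin n) →L[ℝ] ℝ).hasFDerivAt.congr_fderiv ?_
  ext y
  simp [EuclideanSpace.inner_single_left]

lemma gradient_apply_eq_fderiv (f : EuclideanSpace ℝ (Fin n) → ℝ) (x : EuclideanSpace ℝ (Fin n))
    (i : Fin n) : (∇ f x) i = fderiv ℝ f x (EuclideanSpace.single i 1) := by
  rw [← toDual_gradient, InnerProductSpace.toDual_apply_apply, EuclideanSpace.inner_single_right]
  simp

lemma continuousAt_gradient_apply {f : EuclideanSpace ℝ (Fin n) → ℝ} {x : EuclideanSpace ℝ (Fin n)}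
    (hf : ContDiffAt ℝ 1 f x) (i : Fin n) : ContinuousAt (fun y => (∇ f y) i) x := by
  simp only [gradient_apply_eq_fderiv]
  exact (hf.fderiv_right (m := 0) (by norm_num)).continuousAt.clm_apply continuousAt_const

lemma ContDiff.continuous_gradient {f : EuclideanSpace ℝ (Fin n) → ℝ} (hf : ContDiff ℝ 1 f) :
    Continuous (fun y => ∇ f y) :=
  (InnerProductSpace.toDual ℝ (EuclideanSpace ℝ (Fin n))).symm.continuous.comp
    (hf.continuous_fderiv (by norm_num))

lemma tsupport_gradient_subset (f : EuclideanSpace ℝ (Fin n) → ℝ) :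
    tsupport (fun y => ∇ f y) ⊆ tsupport f := by
  refine (closure_mono fun x hx => ?_ : _ ⊆ tsupport (fderiv ℝ f)).trans (tsupport_fderiv_subset ℝ)
  contrapose! hx
  simp only [Function.mem_support, not_not] at hx ⊢
  simp [gradient, hx]

lemma integrable_mul_of_hasCompactSupport {f g : EuclideanSpace ℝ (Fin n) → ℝ}
    (hg : Continuous g) (hgc : HasCompactSupport g) (hf : ∀ x ∈ tsupport g, ContinuousAt f x) :
    Integrable (fun x => f x * g x) := by
  refine Continuous.integrable_of_hasCompactSupport (continuous_of_tsupport fun x hx => ?_)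
    hgc.mul_left
  exact (hf x (tsupport_mul_subset_right hx)).mul hg.continuousAt

lemma continuous_gradient_apply {g : EuclideanSpace ℝ (Fin n) → ℝ} (hg : ContDiff ℝ 1 g)
    (i : Fin n) : Continuous (fun x => (∇ g x) i) :=
  continuous_iff_continuousAt.2 fun _ => continuousAt_gradient_apply hg.contDiffAt i

lemma tsupport_gradient_apply_subset (g : EuclideanSpace ℝ (Fin n) → ℝ) (i : Fin n) :
    tsupport (fun x => (∇ g x) i) ⊆ tsupport g := by
  refine (closure_mono fun x hx => ?_).trans (tsupport_gradient_subset g)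
  contrapose! hx
  simp only [Function.mem_support, not_not] at hx ⊢
  simp [hx]

lemma integrable_mul_gradient_apply {f g : EuclideanSpace ℝ (Fin n) → ℝ} (hg : ContDiff ℝ 1 g)
    (hgc : HasCompactSupport g) (hf : ∀ x ∈ tsupport g, ContinuousAt f x) (i : Fin n) :
    Integrable (fun x => f x * (∇ g x) i) :=
  integrable_mul_of_hasCompactSupport (continuous_gradient_apply hg i)
    (hgc.of_isClosed_subset (isClosed_tsupport _) (tsupport_gradient_apply_subset g i))
    fun x hx => hf x (tsupport_gradient_apply_subset g i hx)

/-- Integration by parts against a compactly supported function. -/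
lemma integral_mul_gradient_apply {f g : EuclideanSpace ℝ (Fin n) → ℝ} (hg : ContDiff ℝ 1 g)
    (hgc : HasCompactSupport g) (hf : ∀ x ∈ tsupport g, ContDiffAt ℝ 1 f x) (i : Fin n) :
    ∫ x, f x * (∇ g x) i = -∫ x, (∇ f x) i * g x := by
  have h1 := integrable_mul_of_hasCompactSupport hg.continuous hgc
    fun x hx => continuousAt_gradient_apply (hf x hx) i
  have h2 := integrable_mul_gradient_apply hg hgc (fun x hx => (hf x hx).continuousAt) i
  have h3 := integrable_mul_of_hasCompactSupport hg.continuous hgc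
    fun x hx => (hf x hx).continuousAt
  simp only [gradient_apply_eq_fderiv] at h1 h2 ⊢
  exact integral_mul_fderiv_eq_neg_fderiv_mul_of_integrable h1 h2 h3
    (fun x hx => (hf x hx).differentiableAt (by norm_num))
    fun x _ => hg.differentiable (by norm_num) x

/-- A vector field that is divergence free near the support of `g` is orthogonal to `∇ g`. -/
lemma integral_inner_gradient_eq_zero {V : EuclideanSpace ℝ (Fin n) → EuclideanSpace ℝ (Fin n)}
    {g : EuclideanSpace ℝ (Fin n) → ℝ} (hg : ContDiff ℝ 1 g) (hgc : HasCompactSupport g)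
    (hV : ∀ x ∈ tsupport g, ∀ i, ContDiffAt ℝ 1 (fun y => V y i) x)
    (hdiv : ∀ x ∈ tsupport g, ∑ i, (∇ (fun y => V y i) x) i = 0) :
    ∫ x, inner ℝ (V x) (∇ g x) = 0 := by
  have e : ∀ x, inner ℝ (V x) (∇ g x) = ∑ i, V x i * (∇ g x) i := fun x => by
    rw [PiLp.inner_apply]
    simp [mul_comm]
  simp only [e]
  rw [integral_finsetSum _ fun i _ => integrable_mul_gradient_apply hg hgc
    (fun x hx => (hV x hx i).continuousAt) i]
  simp only [fun i => integral_mul_gradient_apply hg hgc (fun x hx => hV x hx i) i]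
  rw [Finset.sum_neg_distrib, ← integral_finsetSum _ fun i _ =>
    integrable_mul_of_hasCompactSupport hg.continuous hgc
      fun x hx => continuousAt_gradient_apply (hV x hx i) i, neg_eq_zero]
  refine integral_eq_zero_of_ae (Eventually.of_forall fun x => ?_)
  simp only [← Finset.sum_mul, Pi.zero_apply]
  by_cases hx : x ∈ tsupport g
  · rw [hdiv x hx, zero_mul]
  · rw [image_eq_zero_of_notMem_tsupport hx, mul_zero]

lemma IsTestFunction.contDiff_one {Ω : Set (EuclideanSpace ℝ (Fin n))} {k : ℕ∞} (hk : 1 ≤ k)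
    {φ : EuclideanSpace ℝ (Fin n) → ℝ} (h : IsTestFunction Ω k φ) : ContDiff ℝ 1 φ :=
  h.1.of_le (by exact_mod_cast hk)

/-- `∫ f_k h → ∫ f h` for `f_k → f` in `L¹` and bounded `h`. -/
lemma tendsto_integral_mul_of_tendsto_L1 {X : Type*} [MeasurableSpace X] {μ : Measure X}
    {f : ℕ → X → ℝ} {g h : X → ℝ} {C : ℝ} (hf : ∀ k, Integrable (f k) μ) (hg : Integrable g μ)
    (hh : AEStronglyMeasurable h μ) (hC : ∀ x, |h x| ≤ C)
    (hlim : Tendsto (fun k => ∫ x, |f k x - g x| ∂μ) atTop (𝓝 0)) :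
    Tendsto (fun k => ∫ x, f k x * h x ∂μ) atTop (𝓝 (∫ x, g x * h x ∂μ)) := by
  have hC' : ∀ᵐ x ∂μ, ‖h x‖ ≤ C := Eventually.of_forall hC
  rw [tendsto_iff_norm_sub_tendsto_zero]
  refine squeeze_zero (fun _ => norm_nonneg _) (fun k => ?_)
    (by simpa using hlim.mul_const C)
  rw [← integral_sub ((hf k).mul_bdd hh hC') (hg.mul_bdd hh hC'), ← integral_mul_const]
  refine norm_integral_le_of_norm_le ((((hf k).sub hg).abs).mul_const C)
    (Eventually.of_forall fun x => ?_)
  rw [← sub_mul, norm_mul]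
  exact mul_le_mul_of_nonneg_left (hC x) (abs_nonneg _)

/-- The `L¹` limit of the gradients of test functions is the weak gradient of the limit. -/
lemma hasWeakGradient_of_tendsto {Ω : Set (EuclideanSpace ℝ (Fin n))}
    {u : EuclideanSpace ℝ (Fin n) → ℝ} {G : EuclideanSpace ℝ (Fin n) → EuclideanSpace ℝ (Fin n)}
    (hu : IntegrableOn u Ω) (hG : IntegrableOn G Ω) {φ : ℕ → EuclideanSpace ℝ (Fin n) → ℝ}
    (hφ : ∀ k, IsTestFunction Ω ⊤ (φ k))
    (hφu : Tendsto (fun k => ∫ x in Ω, |φ k x - u x|) atTop (𝓝 0))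
    (hφG : Tendsto (fun k => ∫ x in Ω, ‖∇ (φ k) x - G x‖) atTop (𝓝 0)) :
    HasWeakGradient Ω u G := by
  refine ⟨hu.locallyIntegrableOn, hG.locallyIntegrableOn, fun ψ hψ i => ?_⟩
  have hφ1 : ∀ k, ContDiff ℝ 1 (φ k) := fun k => (hφ k).contDiff_one le_top
  have hψ1 : ContDiff ℝ 1 ψ := hψ.contDiff_one le_top
  obtain ⟨C₁, hC₁⟩ := hψ1.continuous.bounded_above_of_compact_support hψ.2.1
  obtain ⟨C₂, hC₂⟩ := (continuous_gradient_apply hψ1 i).bounded_above_of_compact_support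
    (hψ.2.1.of_isClosed_subset (isClosed_tsupport _) (tsupport_gradient_apply_subset ψ i))
  have hGi : IntegrableOn (fun x => G x i) Ω :=
    (EuclideanSpace.proj i : EuclideanSpace ℝ (Fin n) →L[ℝ] ℝ).integrable_comp hG
  have hφi : ∀ k, Integrable (fun x => (∇ (φ k) x)) := fun k =>
    (hφ1 k).continuous_gradient.integrable_of_hasCompactSupport
      ((hφ k).2.1.of_isClosed_subset (isClosed_tsupport _) (tsupport_gradient_subset _))
  have hφii : ∀ k, Integrable (fun x => (∇ (φ k) x) i) := fun k =>
    (EuclideanSpace.proj i : EuclideanSpace ℝ (Fin n) →L[ℝ] ℝ).integrable_comp (hφi k)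
  have h1 := tendsto_integral_mul_of_tendsto_L1 (μ := volume.restrict Ω)
    (fun k => ((hφ1 k).continuous.integrable_of_hasCompactSupport (hφ k).2.1).integrableOn) hu
    (continuous_gradient_apply hψ1 i).aestronglyMeasurable hC₂ hφu
  have hlim : Tendsto (fun k => ∫ x in Ω, |(∇ (φ k) x) i - G x i|) atTop (𝓝 0) := by
    refine squeeze_zero (fun _ => integral_nonneg fun _ => abs_nonneg _) (fun k => ?_) hφG
    refine integral_mono (((hφii k).integrableOn.sub hGi).abs)
      (((hφi k).integrableOn.sub hG).norm) fun x => ?_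
    simpa using PiLp.norm_apply_le (∇ (φ k) x - G x) i
  have h2 := tendsto_integral_mul_of_tendsto_L1 (μ := volume.restrict Ω)
    (fun k => (hφii k).integrableOn) hGi hψ1.continuous.aestronglyMeasurable hC₁ hlim
  refine tendsto_nhds_unique h1 (h2.neg.congr fun k => ?_)
  have hz : ∀ x ∉ Ω, φ k x = 0 := fun x hx =>
    image_eq_zero_of_notMem_tsupport fun h => hx ((hφ k).2.2 h)
  have hz' : ∀ x ∉ Ω, (∇ (φ k) x) i = 0 := fun x hx =>
    image_eq_zero_of_notMem_tsupport (f := fun x => (∇ (φ k) x) i)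
      fun h => hx ((hφ k).2.2 (tsupport_gradient_apply_subset _ i h))
  rw [setIntegral_eq_integral_of_forall_compl_eq_zero fun x hx => by rw [hz' x hx, zero_mul],
    setIntegral_eq_integral_of_forall_compl_eq_zero fun x hx => by rw [hz x hx, zero_mul],
    integral_mul_gradient_apply hψ1 hψ.2.1 (fun x _ => (hφ1 k).contDiffAt) i]

end Euclidean

/-! ### Cutoff functions -/

/-- A smooth function that vanishes on `(-∞, 1]` and equals `1` on `[2, ∞)`. -/
noncomputable def smoothStep (t : ℝ) : ℝ := Real.smoothTransition (t - 1)

lemma contDiff_smoothStep {m : ℕ∞} : ContDiff ℝ m smoothStep :=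
  Real.smoothTransition.contDiff.comp (contDiff_id.sub contDiff_const)

lemma smoothStep_eq_zero {t : ℝ} (ht : t ≤ 1) : smoothStep t = 0 :=
  Real.smoothTransition.zero_of_nonpos (by linarith)

lemma smoothStep_eq_one {t : ℝ} (ht : 2 ≤ t) : smoothStep t = 1 :=
  Real.smoothTransition.one_of_one_le (by linarith)

lemma deriv_smoothStep_eq_zero_of_lt {t : ℝ} (ht : t < 1) : deriv smoothStep t = 0 := by
  have : smoothStep =ᶠ[𝓝 t] fun _ => 0 := by
    filter_upwards [Iio_mem_nhds ht] with y hy using smoothStep_eq_zero (le_of_lt hy)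
  rw [this.deriv_eq, deriv_const]

lemma deriv_smoothStep_eq_zero_of_gt {t : ℝ} (ht : 2 < t) : deriv smoothStep t = 0 := by
  have : smoothStep =ᶠ[𝓝 t] fun _ => 1 := by
    filter_upwards [Ioi_mem_nhds ht] with y hy using smoothStep_eq_one (le_of_lt hy)
  rw [this.deriv_eq, deriv_const]

/-- The expression t η'(t) is invariant under rescaling of t, so one constant serves all the cutoffs
η((k + 1)ρ) and yields ‖∇ζ‖ ≤ C ‖∇ρ‖ / ρ uniformly in k. -/
lemma exists_abs_mul_deriv_smoothStep_le :
    ∃ C : ℝ, 0 ≤ C ∧ ∀ t : ℝ, |t * deriv smoothStep t| ≤ C := by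
  have hc : Continuous fun t : ℝ => t * deriv smoothStep t :=
    continuous_id.mul ((contDiff_smoothStep (m := 1)).continuous_deriv (by norm_num))
  have hs : HasCompactSupport fun t : ℝ => t * deriv smoothStep t := by
    refine HasCompactSupport.intro (isCompact_Icc (a := (1 : ℝ)) (b := 2)) fun t ht => ?_
    rw [mem_Icc, not_and_or, not_le, not_le] at ht
    rcases ht with ht | ht
    · rw [deriv_smoothStep_eq_zero_of_lt ht, mul_zero]
    · rw [deriv_smoothStep_eq_zero_of_gt ht, mul_zero]
  obtain ⟨C, hC⟩ := hc.bounded_above_of_compact_support hs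
  exact ⟨C, (norm_nonneg _).trans (hC 0), hC⟩

section Cutoff

/-- The cutoff function that vanishes where `(k + 1) ρ ≤ 1` and equals `1` where
`2 ≤ (k + 1) ρ`. -/
noncomputable def cutoff {X : Type*} (ρ : X → ℝ) (k : ℕ) (x : X) : ℝ := smoothStep ((k + 1) * ρ x)

lemma cutoff_nonneg {X : Type*} (ρ : X → ℝ) (k : ℕ) (x : X) : 0 ≤ cutoff ρ k x :=
  Real.smoothTransition.nonneg _

lemma cutoff_le_one {X : Type*} (ρ : X → ℝ) (k : ℕ) (x : X) : cutoff ρ k x ≤ 1 :=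
  Real.smoothTransition.le_one _

lemma tsupport_cutoff_subset {X : Type*} [TopologicalSpace X] {ρ : X → ℝ} (hρ : Continuous ρ) (k : ℕ) :
    tsupport (cutoff ρ k) ⊆ {x | 0 < ρ x} := by
  have hk : (0 : ℝ) < k + 1 := by positivity
  have h : tsupport (cutoff ρ k) ⊆ {x | 1 ≤ (k + 1) * ρ x} := by
    refine closure_minimal (fun x hx => ?_) (isClosed_le continuous_const (by fun_prop))
    by_contra hlt
    exact hx (smoothStep_eq_zero (le_of_lt (not_le.1 hlt)))
  intro x hx
  have := h hx
  simp only [mem_ofPred_eq] at this ⊢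
  exact pos_of_mul_pos_right (by linarith) hk.le

variable {F : Type*} [NormedAddCommGroup F] [InnerProductSpace ℝ F]

lemma contDiff_cutoff {m : ℕ∞} {ρ : F → ℝ} (hρ : ContDiff ℝ m ρ) (k : ℕ) :
    ContDiff ℝ m (cutoff ρ k) :=
  contDiff_smoothStep.comp (contDiff_const.mul hρ)

/-- The factor f may be singular where ρ ≤ 0, because the support of the cutoff is a closed set
inside {ρ > 0}. -/
lemma contDiff_cutoff_mul {m : ℕ∞} {ρ f : F → ℝ} (hρ : ContDiff ℝ m ρ)
    (hf : ∀ x, 0 < ρ x → ContDiffAt ℝ m f x) (k : ℕ) :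
    ContDiff ℝ m (fun x => cutoff ρ k x * f x) := by
  refine contDiff_iff_contDiffAt.2 fun x => ?_
  by_cases hx : x ∈ tsupport (cutoff ρ k)
  · exact (contDiff_cutoff hρ k).contDiffAt.mul (hf x (tsupport_cutoff_subset hρ.continuous k hx))
  · refine contDiffAt_const (c := (0 : ℝ)).congr_of_eventuallyEq ?_
    filter_upwards [notMem_tsupport_iff_eventuallyEq.1 hx] with y hy
    rw [hy, Pi.zero_apply, zero_mul]

variable [CompleteSpace F]

lemma hasGradientAt_cutoff {ρ : F → ℝ} {x ρ' : F} (hρ : HasGradientAt ρ ρ' x) (k : ℕ) :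
    HasGradientAt (cutoff ρ k) ((deriv smoothStep ((k + 1) * ρ x) * (k + 1)) • ρ') x := by
  have h : HasDerivAt (fun t : ℝ => smoothStep ((k + 1) * t))
      (deriv smoothStep ((k + 1) * ρ x) * (k + 1)) (ρ x) := by
    have h1 : HasDerivAt smoothStep (deriv smoothStep ((k + 1) * ρ x)) ((k + 1) * ρ x) :=
      (contDiff_smoothStep (m := 1)).differentiable (by norm_num) |>.differentiableAt.hasDerivAt
    simpa [Function.comp_def] using h1.comp (ρ x) ((hasDerivAt_id (ρ x)).const_mul (k + 1 : ℝ))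
  exact h.comp_hasGradientAt hρ

lemma exists_norm_gradient_cutoff_le : ∃ C : ℝ, 0 ≤ C ∧ ∀ (ρ : F → ℝ) (k : ℕ) (x ρ' : F),
    HasGradientAt ρ ρ' x → 0 < ρ x → ‖∇ (cutoff ρ k) x‖ ≤ C * (‖ρ'‖ / ρ x) := by
  obtain ⟨C, hC0, hC⟩ := exists_abs_mul_deriv_smoothStep_le
  refine ⟨C, hC0, fun ρ k x ρ' hρ hx => ?_⟩
  rw [(hasGradientAt_cutoff hρ k).gradient, norm_smul, Real.norm_eq_abs]
  have h := hC ((k + 1) * ρ x)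
  rw [← mul_div_assoc, le_div_iff₀ hx]
  have e : |deriv smoothStep ((k + 1) * ρ x) * (k + 1)| * ‖ρ'‖ * ρ x =
      |(k + 1) * ρ x * deriv smoothStep ((k + 1) * ρ x)| * ‖ρ'‖ := by
    rw [show (k + 1) * ρ x * deriv smoothStep ((k + 1) * ρ x) =
      deriv smoothStep ((k + 1) * ρ x) * (k + 1) * ρ x by ring, abs_mul _ (ρ x), abs_of_pos hx]
    ring
  rw [e]
  exact mul_le_mul_of_nonneg_right h (norm_nonneg _)

lemma eventually_cutoff_eq_one {ρ : F → ℝ} {x ρ' : F} (hρ : HasGradientAt ρ ρ' x)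
    (hx : 0 < ρ x) : ∀ᶠ k in atTop, cutoff ρ k x = 1 ∧ ∇ (cutoff ρ k) x = 0 := by
  have h : Tendsto (fun k : ℕ => ((k : ℝ) + 1) * ρ x) atTop atTop :=
    (tendsto_atTop_add_const_right _ _ tendsto_natCast_atTop_atTop).atTop_mul_const hx
  filter_upwards [h.eventually_gt_atTop 2] with k hk
  refine ⟨smoothStep_eq_one hk.le, ?_⟩
  rw [(hasGradientAt_cutoff hρ k).gradient, deriv_smoothStep_eq_zero_of_gt hk, zero_mul, zero_smul]

end Cutoff

/-! ### The solution, its gradient and its flux -/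

section Radial

variable {n : ℕ}

lemma hasGradientAt_coord_mul_radial (i : Fin n) {α : ℝ → ℝ} {α' : ℝ}
    {x : EuclideanSpace ℝ (Fin n)} (hα : HasDerivAt α α' (‖x‖ ^ 2)) :
    HasGradientAt (fun y : EuclideanSpace ℝ (Fin n) => y i * α (‖y‖ ^ 2))
      (α (‖x‖ ^ 2) • EuclideanSpace.single i 1 + (2 * α' * x i) • x) x := by
  have h := (hasGradientAt_coord i x).mul_real (hα.comp_hasGradientAt
    (f := fun y : EuclideanSpace ℝ (Fin n) => ‖y‖ ^ 2) (hasGradientAt_norm_sq x))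
  convert h using 1
  rw [smul_smul, smul_smul, add_comm]
  congr 2
  ring

/-- The divergence of the vector field `α(‖x‖²) eᵢ + β(‖x‖²) xᵢ x`. -/
lemma sum_gradient_apply_of_radial (i : Fin n) {α β : ℝ → ℝ} {α' β' : ℝ}
    {x : EuclideanSpace ℝ (Fin n)} (hα : HasDerivAt α α' (‖x‖ ^ 2))
    (hβ : HasDerivAt β β' (‖x‖ ^ 2)) :
    ∑ j, (∇ (fun y : EuclideanSpace ℝ (Fin n) => (α (‖y‖ ^ 2) • EuclideanSpace.single i (1 : ℝ) +
      (β (‖y‖ ^ 2) * y i) • y : EuclideanSpace ℝ (Fin n)) j) x) j =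
      x i * (2 * α' + 2 * ‖x‖ ^ 2 * β' + (n + 1) * β (‖x‖ ^ 2)) := by
  have key : ∀ j, (∇ (fun y : EuclideanSpace ℝ (Fin n) =>
      (α (‖y‖ ^ 2) • EuclideanSpace.single i (1 : ℝ) +
      (β (‖y‖ ^ 2) * y i) • y : EuclideanSpace ℝ (Fin n)) j) x) j =
      (if j = i then 2 * α' * x i + β (‖x‖ ^ 2) * x i else 0) +
        x i * β (‖x‖ ^ 2) + 2 * β' * x i * x j ^ 2 := by
    intro j
    have h1 := (hα.comp_hasGradientAt
    (f := fun y : EuclideanSpace ℝ (Fin n) => ‖y‖ ^ 2) (hasGradientAt_norm_sq x)).hasFDerivAt.mul_const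
      ((EuclideanSpace.single i (1 : ℝ) : EuclideanSpace ℝ (Fin n)) j)
    have h2 := ((hasGradientAt_coord_mul_radial i hβ).mul_real (hasGradientAt_coord j x)).hasFDerivAt
    have h3 := (h1.add h2).congr_of_eventuallyEq (f₁ := fun y : EuclideanSpace ℝ (Fin n) =>
      (α (‖y‖ ^ 2) • EuclideanSpace.single i (1 : ℝ) +
      (β (‖y‖ ^ 2) * y i) • y : EuclideanSpace ℝ (Fin n)) j)
      (Eventually.of_forall fun y => by
        simp only [PiLp.add_apply, PiLp.smul_apply, Pi.add_apply, smul_eq_mul]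
        ring)
    rw [gradient_apply_eq_fderiv, h3.fderiv]
    by_cases hij : j = i
    · subst hij
      simp [EuclideanSpace.inner_single_right]
      ring
    · simp [EuclideanSpace.inner_single_right, hij]
      ring
  have hsq : ∑ j, 2 * β' * x i * x j ^ 2 = 2 * β' * x i * ‖x‖ ^ 2 := by
    rw [← Finset.mul_sum, EuclideanSpace.real_norm_sq_eq]
  rw [Finset.sum_congr rfl fun j _ => key j, Finset.sum_add_distrib, Finset.sum_add_distrib,
    Finset.sum_ite_eq' Finset.univ i, hsq]
  simp
  ring

end Radial

namespace RadialProfile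

variable {n : ℕ}

/-- The pathological solution `xᵢ k(‖x‖²)`. -/
noncomputable def solution (i : Fin n) (x : EuclideanSpace ℝ (Fin n)) : ℝ :=
  x i * profile n (‖x‖ ^ 2)

/-- The gradient of `solution`. -/
noncomputable def solutionGrad (i : Fin n) (x : EuclideanSpace ℝ (Fin n)) :
    EuclideanSpace ℝ (Fin n) :=
  profile n (‖x‖ ^ 2) • EuclideanSpace.single i 1 + (2 * profileDeriv n (‖x‖ ^ 2) * x i) • x

/-- The flux `A ∇u` of `solution`. -/
noncomputable def flux (i : Fin n) (x : EuclideanSpace ℝ (Fin n)) : EuclideanSpace ℝ (Fin n) :=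
  fluxConst n (‖x‖ ^ 2) • EuclideanSpace.single i 1 + (fluxQuad n (‖x‖ ^ 2) * x i) • x

/-- The coefficient matrix, with eigenvalue `radialCoeff` in the direction of `x` and
`tangentialCoeff` in the orthogonal directions. -/
noncomputable def coeffMatrix (x : EuclideanSpace ℝ (Fin n)) : Matrix (Fin n) (Fin n) ℝ :=
  tangentialCoeff n (‖x‖ ^ 2) • (1 : Matrix (Fin n) (Fin n) ℝ) +
    ((radialCoeff n (‖x‖ ^ 2) - tangentialCoeff n (‖x‖ ^ 2)) / ‖x‖ ^ 2) •
      Matrix.vecMulVec x.ofLp x.ofLp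

lemma normSq_pos {x : EuclideanSpace ℝ (Fin n)} (hx : x ≠ 0) : 0 < ‖x‖ ^ 2 :=
  pow_pos (norm_pos_iff.2 hx) 2

lemma normSq_lt_one {x : EuclideanSpace ℝ (Fin n)} (hx : x ∈ Metric.ball 0 1) : ‖x‖ ^ 2 < 1 := by
  rw [mem_ball_zero_iff] at hx
  nlinarith [norm_nonneg x]

lemma hasGradientAt_solution (i : Fin n) {x : EuclideanSpace ℝ (Fin n)} (hx : x ≠ 0) :
    HasGradientAt (solution i) (solutionGrad i x) x :=
  hasGradientAt_coord_mul_radial i (hasDerivAt_profile n (normSq_pos hx))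

lemma contDiffAt_coord {m : WithTop ℕ∞} (i : Fin n) (x : EuclideanSpace ℝ (Fin n)) :
    ContDiffAt ℝ m (fun y : EuclideanSpace ℝ (Fin n) => y i) x :=
  (EuclideanSpace.proj i : EuclideanSpace ℝ (Fin n) →L[ℝ] ℝ).contDiff.contDiffAt

lemma contDiffAt_solution {m : WithTop ℕ∞} (i : Fin n) {x : EuclideanSpace ℝ (Fin n)}
    (hx : x ≠ 0) : ContDiffAt ℝ m (solution i) x :=
  (contDiffAt_coord i x).mul ((contDiffAt_profile n (normSq_pos hx)).comp x
    (contDiff_norm_sq ℝ).contDiffAt)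

lemma contDiffAt_flux {m : WithTop ℕ∞} (i j : Fin n) {x : EuclideanSpace ℝ (Fin n)}
    (hx : x ≠ 0) : ContDiffAt ℝ m (fun y => flux i y j) x := by
  have h1 : ContDiffAt ℝ m (fun y : EuclideanSpace ℝ (Fin n) => fluxConst n (‖y‖ ^ 2)) x :=
    (contDiffAt_fluxConst n (normSq_pos hx)).comp x (contDiff_norm_sq ℝ).contDiffAt
  have h2 : ContDiffAt ℝ m (fun y : EuclideanSpace ℝ (Fin n) => fluxQuad n (‖y‖ ^ 2)) x :=
    (contDiffAt_fluxQuad n (normSq_pos hx)).comp x (contDiff_norm_sq ℝ).contDiffAt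
  exact (h1.mul contDiffAt_const).add ((h2.mul (contDiffAt_coord i x)).mul (contDiffAt_coord j x))

lemma sum_gradient_flux (hn : 2 ≤ n) (i : Fin n) {x : EuclideanSpace ℝ (Fin n)} (hx : x ≠ 0) :
    ∑ j, (∇ (fun y => flux i y j) x) j = 0 := by
  obtain ⟨α', β', hα, hβ, h⟩ :=
    exists_hasDerivAt_flux (d := n) (by exact_mod_cast hn) (normSq_pos hx)
  have := sum_gradient_apply_of_radial i hα hβ
  rw [h, mul_zero] at this
  exact this

/-- At the origin the convention `Real.log 0 = 0` gives `invPow d 0 = 1`, so the profile vanishes.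
With this value, and likewise for the flux and the matrix, the pointwise bounds and A∇u = flux hold
on the whole ball without excluding 0. -/
lemma solutionGrad_zero (i : Fin n) : solutionGrad i 0 = 0 := by
  simp [solutionGrad, profile, invPow]

lemma flux_zero (i : Fin n) : flux i 0 = 0 := by
  simp [flux, fluxConst, profile, invPow, tangentialFlux]

lemma coeffMatrix_zero : coeffMatrix (0 : EuclideanSpace ℝ (Fin n)) = 1 := by
  simp [coeffMatrix, tangentialCoeff]

lemma coeffMatrix_mulVec (x : EuclideanSpace ℝ (Fin n)) (v : Fin n → ℝ) :
    coeffMatrix x *ᵥ v = tangentialCoeff n (‖x‖ ^ 2) • v +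
      ((radialCoeff n (‖x‖ ^ 2) - tangentialCoeff n (‖x‖ ^ 2)) / ‖x‖ ^ 2 * (x.ofLp ⬝ᵥ v)) •
        x.ofLp := by
  rw [coeffMatrix, Matrix.add_mulVec, Matrix.smul_mulVec, Matrix.one_mulVec, Matrix.smul_mulVec,
    Matrix.vecMulVec_mulVec]
  ext j
  simp
  ring

lemma dotProduct_self_eq (x : EuclideanSpace ℝ (Fin n)) : x.ofLp ⬝ᵥ x.ofLp = ‖x‖ ^ 2 := by
  rw [EuclideanSpace.real_norm_sq_eq, dotProduct]
  simp [sq]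

/-- Splitting eᵢ into xᵢ x / ‖x‖² and a vector orthogonal to x reduces the claim to the two scalar
identities `tangentialCoeff_mul_profile` and `radialCoeff_mul`. -/
lemma coeffMatrix_mulVec_solutionGrad (hn : 2 ≤ n) (i : Fin n) {x : EuclideanSpace ℝ (Fin n)}
    (hx : x ∈ Metric.ball 0 1) : coeffMatrix x *ᵥ (solutionGrad i x).ofLp = (flux i x).ofLp := by
  rcases eq_or_ne x 0 with rfl | hx0
  · simp [solutionGrad_zero, flux_zero]
  have hd : (2 : ℝ) ≤ n := by exact_mod_cast hn
  have hs := normSq_pos hx0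
  have h1 := tangentialCoeff_mul_profile hd hs (normSq_lt_one hx)
  have h2 := radialCoeff_mul hd hs (normSq_lt_one hx)
  have h3 : x.ofLp ⬝ᵥ (solutionGrad i x).ofLp =
      profile n (‖x‖ ^ 2) * x i + 2 * profileDeriv n (‖x‖ ^ 2) * x i * ‖x‖ ^ 2 := by
    simp [solutionGrad, dotProduct_add, dotProduct_smul, dotProduct_self_eq]
  rw [coeffMatrix_mulVec, h3]
  ext j
  simp only [solutionGrad, flux, PiLp.add_apply, PiLp.smul_apply, Pi.add_apply, Pi.smul_apply,
    smul_eq_mul, WithLp.ofLp_add, WithLp.ofLp_smul]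
  have e : (radialCoeff n (‖x‖ ^ 2) - tangentialCoeff n (‖x‖ ^ 2)) / ‖x‖ ^ 2 *
      (profile n (‖x‖ ^ 2) * x i + 2 * profileDeriv n (‖x‖ ^ 2) * x i * ‖x‖ ^ 2) =
      (radialCoeff n (‖x‖ ^ 2) * (2 * profileDeriv n (‖x‖ ^ 2) + profile n (‖x‖ ^ 2) / ‖x‖ ^ 2)
        - tangentialCoeff n (‖x‖ ^ 2) * profile n (‖x‖ ^ 2) / ‖x‖ ^ 2
        - 2 * tangentialCoeff n (‖x‖ ^ 2) * profileDeriv n (‖x‖ ^ 2)) * x i := by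
    field_simp
    ring
  rw [e, h2, ← h1]
  ring

lemma abs_apply_le_norm (x : EuclideanSpace ℝ (Fin n)) (i : Fin n) : |x i| ≤ ‖x‖ :=
  PiLp.norm_apply_le x i

lemma norm_radial_le (i : Fin n) (a b : ℝ) (x : EuclideanSpace ℝ (Fin n)) :
    ‖a • EuclideanSpace.single i (1 : ℝ) + (b * x i) • x‖ ≤ |a| + |b| * ‖x‖ ^ 2 := by
  refine (norm_add_le _ _).trans (add_le_add ?_ ?_)
  · simp [norm_smul]
  · rw [norm_smul, Real.norm_eq_abs, abs_mul, mul_assoc, sq]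
    gcongr
    exact abs_apply_le_norm x i

lemma norm_solutionGrad_le (hn : 2 ≤ n) (i : Fin n) {x : EuclideanSpace ℝ (Fin n)}
    (hx : x ∈ Metric.ball 0 1) : ‖solutionGrad i x‖ ≤ (2 * n + 1) * majorant x := by
  rcases eq_or_ne x 0 with rfl | hx0
  · rw [solutionGrad_zero, norm_zero]
    exact mul_nonneg (by positivity) (majorant_pos _).le
  have hd : (2 : ℝ) ≤ n := by exact_mod_cast hn
  have hs := normSq_pos hx0
  have h1 := abs_profileDeriv_le hd hs (normSq_lt_one hx)
  have h2 := profile_le n (‖x‖ ^ 2)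
  have h3 := profile_pos hd hs (normSq_lt_one hx)
  refine (norm_radial_le i _ _ x).trans ?_
  rw [abs_of_pos h3, abs_mul, abs_two, majorant]
  linarith

lemma norm_flux_le (hn : 2 ≤ n) (i : Fin n) {x : EuclideanSpace ℝ (Fin n)}
    (hx : x ∈ Metric.ball 0 1) : ‖flux i x‖ ≤ (n + 3) * majorant x := by
  rcases eq_or_ne x 0 with rfl | hx0
  · rw [flux_zero, norm_zero]
    exact mul_nonneg (by positivity) (majorant_pos _).le
  have hd : (2 : ℝ) ≤ n := by exact_mod_cast hn
  have hs := normSq_pos hx0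
  have h1 := abs_fluxConst_le hd hs (normSq_lt_one hx)
  have h2 := abs_fluxQuad_le hd hs (normSq_lt_one hx)
  refine (norm_radial_le i _ _ x).trans ?_
  rw [majorant]
  linarith

lemma abs_solution_le (hn : 2 ≤ n) (i : Fin n) {x : EuclideanSpace ℝ (Fin n)} (hx0 : x ≠ 0)
    (hx : x ∈ Metric.ball 0 1) : |solution i x| ≤ ‖x‖ * profile n (‖x‖ ^ 2) := by
  have hd : (2 : ℝ) ≤ n := by exact_mod_cast hn
  have h3 := profile_pos hd (normSq_pos hx0) (normSq_lt_one hx)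
  rw [solution, abs_mul, abs_of_pos h3]
  exact mul_le_mul_of_nonneg_right (abs_apply_le_norm x i) h3.le

lemma abs_solution_le_majorant (hn : 2 ≤ n) (i : Fin n) {x : EuclideanSpace ℝ (Fin n)}
    (hx : x ∈ Metric.ball 0 1) : |solution i x| ≤ majorant x := by
  rcases eq_or_ne x 0 with rfl | hx0
  · simpa [solution] using (majorant_pos (0 : EuclideanSpace ℝ (Fin n))).le
  have hd : (2 : ℝ) ≤ n := by exact_mod_cast hn
  have h3 := profile_pos hd (normSq_pos hx0) (normSq_lt_one hx)
  refine (abs_solution_le hn i hx0 hx).trans (le_trans ?_ (profile_le n (‖x‖ ^ 2)))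
  rw [mem_ball_zero_iff] at hx
  exact mul_le_of_le_one_left h3.le hx.le

/-! ### Measurability, and parity of the flux. -/

lemma measurable_logWeight : Measurable logWeight := by
  unfold logWeight; fun_prop

lemma measurable_invPow (d : ℝ) : Measurable (invPow d) := by
  unfold invPow; fun_prop

lemma measurable_profile (d : ℝ) : Measurable (profile d) := by
  have h1 := measurable_logWeight
  have h2 := measurable_invPow d
  unfold profile; fun_prop

lemma measurable_profileDeriv (d : ℝ) : Measurable (profileDeriv d) := by
  have h1 := measurable_logWeight
  have h2 := measurable_invPow d
  unfold profileDeriv; fun_prop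

lemma measurable_tangentialFlux (d : ℝ) : Measurable (tangentialFlux d) := by
  have h1 := measurable_logWeight
  have h2 := measurable_invPow d
  unfold tangentialFlux; fun_prop

lemma measurable_fluxConst (d : ℝ) : Measurable (fluxConst d) :=
  (measurable_profile d).add (measurable_tangentialFlux d)

lemma measurable_fluxQuad (d : ℝ) : Measurable (fluxQuad d) := by
  have h1 := measurable_logWeight
  have h2 := measurable_invPow d
  have h3 := measurable_tangentialFlux d
  unfold fluxQuad; fun_prop

lemma measurable_coord (i : Fin n) : Measurable fun x : EuclideanSpace ℝ (Fin n) => x i :=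
  (EuclideanSpace.proj i : EuclideanSpace ℝ (Fin n) →L[ℝ] ℝ).continuous.measurable

lemma measurable_solution (i : Fin n) : Measurable (solution i) := by
  have h1 := measurable_profile n
  have h2 := measurable_coord i
  unfold solution; fun_prop

lemma measurable_solutionGrad (i : Fin n) : Measurable (solutionGrad i) := by
  have h1 := measurable_profile n
  have h2 := measurable_coord i
  have h3 := measurable_profileDeriv n
  unfold solutionGrad; fun_prop

lemma measurable_flux (i : Fin n) : Measurable (flux i) := by
  have h1 := measurable_fluxConst n
  have h2 := measurable_coord i
  have h3 := measurable_fluxQuad n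
  unfold flux; fun_prop

lemma flux_neg (i : Fin n) (x : EuclideanSpace ℝ (Fin n)) : flux i (-x) = flux i x := by
  simp [flux]

/-! ### Ellipticity and continuity of the coefficients -/

lemma isElliptic_coeffMatrix (hn : 2 ≤ n) :
    IsElliptic (Metric.ball 0 1) (coeffMatrix (n := n)) := by
  -- The eigenvalues lie in [1 - 3/8, 1] and [1, 1 + 2 · 3/8].
  refine ⟨5 / 8, 2, by norm_num, by norm_num, fun x hx => ⟨?_, fun ξ => ?_⟩⟩
  · rw [coeffMatrix, Matrix.IsSymm, Matrix.transpose_add, Matrix.transpose_smul,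
      Matrix.transpose_smul, Matrix.transpose_one, Matrix.transpose_vecMulVec]
  rcases eq_or_ne x 0 with rfl | hx0
  · rw [coeffMatrix_zero, Matrix.one_mulVec, dotProduct_self_eq]
    constructor <;> nlinarith [sq_nonneg ‖ξ‖]
  have hd : (2 : ℝ) ≤ n := by exact_mod_cast hn
  have hs := normSq_pos hx0
  have hs1 := normSq_lt_one hx
  have h1 := tangentialCoeff_bounds hd hs hs1
  have h2 := radialCoeff_bounds hd hs hs1
  have h3 := coeffModulus_le hs hs1
  have hcs : (x.ofLp ⬝ᵥ ξ.ofLp) ^ 2 ≤ ‖x‖ ^ 2 * ‖ξ‖ ^ 2 := by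
    rw [EuclideanSpace.real_norm_sq_eq, EuclideanSpace.real_norm_sq_eq]
    exact Finset.sum_mul_sq_le_sq_mul_sq _ _ _
  rw [coeffMatrix_mulVec, add_dotProduct, smul_dotProduct, smul_dotProduct, dotProduct_self_eq]
  simp only [smul_eq_mul]
  have e : (radialCoeff n (‖x‖ ^ 2) - tangentialCoeff n (‖x‖ ^ 2)) / ‖x‖ ^ 2 *
      (x.ofLp ⬝ᵥ ξ.ofLp) * (x.ofLp ⬝ᵥ ξ.ofLp) =
      (radialCoeff n (‖x‖ ^ 2) - tangentialCoeff n (‖x‖ ^ 2)) *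
        ((x.ofLp ⬝ᵥ ξ.ofLp) ^ 2 / ‖x‖ ^ 2) := by ring
  have h4 : (x.ofLp ⬝ᵥ ξ.ofLp) ^ 2 / ‖x‖ ^ 2 ≤ ‖ξ‖ ^ 2 := by
    rw [div_le_iff₀ hs]; linarith
  have h5 : 0 ≤ (x.ofLp ⬝ᵥ ξ.ofLp) ^ 2 / ‖x‖ ^ 2 := by positivity
  rw [e]
  -- Here z is the squared length of the radial part of ξ. The quadratic form is a‖ξ‖² + (b - a)z
  -- with a ≤ b the two eigenvalues and 0 ≤ z ≤ ‖ξ‖².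
  generalize (x.ofLp ⬝ᵥ ξ.ofLp) ^ 2 / ‖x‖ ^ 2 = z at *
  have h6 : 0 ≤ radialCoeff n (‖x‖ ^ 2) - tangentialCoeff n (‖x‖ ^ 2) := by linarith [h1.1, h2.1]
  constructor
  · nlinarith [mul_nonneg h6 h5, sq_nonneg ‖ξ‖]
  · nlinarith [mul_le_mul_of_nonneg_left h4 h6, sq_nonneg ‖ξ‖]

lemma tendsto_normSq_punctured : Tendsto (fun x : EuclideanSpace ℝ (Fin n) => ‖x‖ ^ 2)
    (𝓝[≠] 0) (𝓝[>] 0) := by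
  refine tendsto_nhdsWithin_iff.2 ⟨?_, ?_⟩
  · have : Continuous fun x : EuclideanSpace ℝ (Fin n) => ‖x‖ ^ 2 := by fun_prop
    simpa using (this.tendsto 0).mono_left nhdsWithin_le_nhds
  · filter_upwards [self_mem_nhdsWithin] with x hx using normSq_pos hx

/-- The deviation is at most (1 - a) + (b - a) = 2(1 - a) + (b - 1) for the tangential and radial
eigenvalues a and b, hence the factor 4. -/
lemma abs_coeffMatrix_sub_le (hn : 2 ≤ n) {x : EuclideanSpace ℝ (Fin n)} (hx0 : x ≠ 0)
    (hx : x ∈ Metric.ball 0 1) (i j : Fin n) :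
    |coeffMatrix x i j - (1 : Matrix (Fin n) (Fin n) ℝ) i j| ≤ 4 * coeffModulus (‖x‖ ^ 2) := by
  have hd : (2 : ℝ) ≤ n := by exact_mod_cast hn
  have hs := normSq_pos hx0
  have hs1 := normSq_lt_one hx
  have h1 := tangentialCoeff_bounds hd hs hs1
  have h2 := radialCoeff_bounds hd hs hs1
  have e : coeffMatrix x i j - (1 : Matrix (Fin n) (Fin n) ℝ) i j =
      (tangentialCoeff n (‖x‖ ^ 2) - 1) * (1 : Matrix (Fin n) (Fin n) ℝ) i j +
      (radialCoeff n (‖x‖ ^ 2) - tangentialCoeff n (‖x‖ ^ 2)) * (x i * x j / ‖x‖ ^ 2) := by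
    simp [coeffMatrix, Matrix.vecMulVec_apply]
    ring
  have hδ : |(1 : Matrix (Fin n) (Fin n) ℝ) i j| ≤ 1 := by
    rw [Matrix.one_apply]; split_ifs <;> simp
  have hx2 : |x i * x j / ‖x‖ ^ 2| ≤ 1 := by
    rw [abs_div, abs_mul, abs_of_pos hs, div_le_one hs, sq]
    exact mul_le_mul (abs_apply_le_norm x i) (abs_apply_le_norm x j) (abs_nonneg _) (norm_nonneg _)
  rw [e]
  refine (abs_add_le _ _).trans ?_
  rw [abs_mul, abs_mul, abs_of_nonneg (a := radialCoeff _ _ - _) (by linarith [h1.1, h2.1]),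
    abs_of_nonpos (a := tangentialCoeff _ _ - 1) (by linarith [h1.1])]
  have h3 : -(tangentialCoeff n (‖x‖ ^ 2) - 1) * |(1 : Matrix (Fin n) (Fin n) ℝ) i j| ≤
      1 - tangentialCoeff n (‖x‖ ^ 2) := by
    rw [neg_sub]; exact mul_le_of_le_one_right h1.1 hδ
  have h4 : (radialCoeff n (‖x‖ ^ 2) - tangentialCoeff n (‖x‖ ^ 2)) * |x i * x j / ‖x‖ ^ 2| ≤
      radialCoeff n (‖x‖ ^ 2) - tangentialCoeff n (‖x‖ ^ 2) :=
    mul_le_of_le_one_right (by linarith [h1.1, h2.1]) hx2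
  linarith [h1.2, h2.2]

lemma continuousOn_coeffMatrix (hn : 2 ≤ n) :
    ContinuousOn (coeffMatrix (n := n)) (Metric.ball 0 1) := by
  have hd : (2 : ℝ) ≤ n := by exact_mod_cast hn
  intro x hx
  refine ContinuousAt.continuousWithinAt ?_
  rcases eq_or_ne x 0 with rfl | hx0
  · rw [continuousAt_iff_punctured_nhds, coeffMatrix_zero]
    refine tendsto_pi_nhds.2 fun i => tendsto_pi_nhds.2 fun j => ?_
    have h := (tendsto_coeffModulus.comp (tendsto_normSq_punctured (n := n))).const_mul 4
    rw [mul_zero] at h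
    rw [tendsto_iff_norm_sub_tendsto_zero]
    refine squeeze_zero' (Eventually.of_forall fun _ => norm_nonneg _) ?_ h
    filter_upwards [self_mem_nhdsWithin,
      mem_nhdsWithin_of_mem_nhds (Metric.ball_mem_nhds 0 one_pos)] with y hy0 hy
    exact abs_coeffMatrix_sub_le hn hy0 hy i j
  · have hs := normSq_pos hx0
    have hs1 := normSq_lt_one hx
    have hN : ContinuousAt (fun y : EuclideanSpace ℝ (Fin n) => ‖y‖ ^ 2) x := by fun_prop
    have h1 : ContinuousAt (fun y : EuclideanSpace ℝ (Fin n) => tangentialCoeff n (‖y‖ ^ 2)) x :=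
      ContinuousAt.comp (f := fun y : EuclideanSpace ℝ (Fin n) => ‖y‖ ^ 2)
        (continuousAt_tangentialCoeff hd hs hs1) hN
    have h2 : ContinuousAt (fun y : EuclideanSpace ℝ (Fin n) => radialCoeff n (‖y‖ ^ 2)) x :=
      ContinuousAt.comp (f := fun y : EuclideanSpace ℝ (Fin n) => ‖y‖ ^ 2)
        (continuousAt_radialCoeff hd hs hs1) hN
    have h3 : ContinuousAt (fun y : EuclideanSpace ℝ (Fin n) =>
        Matrix.vecMulVec y.ofLp y.ofLp) x := by
      have : Continuous (fun y : EuclideanSpace ℝ (Fin n) => Matrix.vecMulVec y.ofLp y.ofLp) :=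
        Continuous.matrix_vecMulVec (by fun_prop) (by fun_prop)
      exact this.continuousAt
    exact (h1.smul continuousAt_const).add (((h2.sub h1).div hN hs.ne').smul h3)

end RadialProfile

namespace RadialProfile

variable {n : ℕ}

/-! ### The solution belongs to `W^{1,1}_0` -/

/-- The function `‖x‖² (1 - ‖x‖²)`, positive exactly on the punctured open unit ball. -/
noncomputable def puncturedDefining (x : EuclideanSpace ℝ (Fin n)) : ℝ := ‖x‖ ^ 2 * (1 - ‖x‖ ^ 2)

lemma puncturedDefining_pos_iff {x : EuclideanSpace ℝ (Fin n)} :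
    0 < puncturedDefining x ↔ x ≠ 0 ∧ x ∈ Metric.ball 0 1 := by
  constructor
  · intro h
    have hx0 : x ≠ 0 := by
      rintro rfl
      simp [puncturedDefining] at h
    refine ⟨hx0, ?_⟩
    have h1 : 0 < 1 - ‖x‖ ^ 2 := pos_of_mul_pos_right h (by positivity)
    rw [mem_ball_zero_iff]
    nlinarith [norm_nonneg x]
  · rintro ⟨hx0, hx⟩
    exact mul_pos (normSq_pos hx0) (by linarith [normSq_lt_one hx])

lemma contDiff_puncturedDefining {m : WithTop ℕ∞} :
    ContDiff ℝ m (puncturedDefining (n := n)) :=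
  (contDiff_norm_sq ℝ).mul (contDiff_const.sub (contDiff_norm_sq ℝ))

lemma hasGradientAt_puncturedDefining (x : EuclideanSpace ℝ (Fin n)) :
    HasGradientAt puncturedDefining ((2 * (1 - 2 * ‖x‖ ^ 2)) • x) x := by
  have h : HasDerivAt (fun s : ℝ => s * (1 - s)) (1 * (1 - ‖x‖ ^ 2) + ‖x‖ ^ 2 * -1) (‖x‖ ^ 2) :=
    (hasDerivAt_id' _).mul ((hasDerivAt_id' _).const_sub 1)
  have h2 := h.comp_hasGradientAt (f := fun y : EuclideanSpace ℝ (Fin n) => ‖y‖ ^ 2)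
    (hasGradientAt_norm_sq x)
  rw [smul_smul] at h2
  have e : 2 * (1 - 2 * ‖x‖ ^ 2) = (1 * (1 - ‖x‖ ^ 2) + ‖x‖ ^ 2 * -1) * 2 := by ring
  rw [e]
  exact h2

/-- This controls u∇ζ for the cutoffs of `puncturedDefining`. Near the sphere the linear vanishing
of u compensates 1 / (1 - ‖x‖²); near the origin u / ‖x‖ is still of the size of the majorant. -/
lemma abs_solution_mul_le (hn : 2 ≤ n) (i : Fin n) {x : EuclideanSpace ℝ (Fin n)} (hx0 : x ≠ 0)
    (hx : x ∈ Metric.ball 0 1) :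
    |solution i x| * (‖(2 * (1 - 2 * ‖x‖ ^ 2)) • x‖ / puncturedDefining x) ≤ n * majorant x := by
  have hd : (2 : ℝ) ≤ n := by exact_mod_cast hn
  have hs := normSq_pos hx0
  have hs1 := normSq_lt_one hx
  have h1 := abs_solution_le hn i hx0 hx
  have h2 := profile_le_one_sub hd hs
  have h3 := profile_pos hd hs hs1
  have h4 : |2 * (1 - 2 * ‖x‖ ^ 2)| ≤ 2 := by
    rw [abs_le]; constructor <;> linarith
  rw [norm_smul, Real.norm_eq_abs, ← mul_div_assoc, div_le_iff₀
    (puncturedDefining_pos_iff.2 ⟨hx0, hx⟩)]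
  calc |solution i x| * (|2 * (1 - 2 * ‖x‖ ^ 2)| * ‖x‖)
      ≤ ‖x‖ * profile n (‖x‖ ^ 2) * (2 * ‖x‖) := by gcongr
    _ = 2 * ‖x‖ ^ 2 * profile n (‖x‖ ^ 2) := by ring
    _ ≤ 2 * ‖x‖ ^ 2 *
        (n / 2 * (1 - ‖x‖ ^ 2) * (logWeight (‖x‖ ^ 2) * invPow n (‖x‖ ^ 2))) := by gcongr
    _ = n * majorant x * puncturedDefining x := by rw [majorant, puncturedDefining]; ring

lemma ae_mem_ball_ne_zero (hn : 2 ≤ n) :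
    ∀ᵐ x ∂(volume.restrict (Metric.ball (0 : EuclideanSpace ℝ (Fin n)) 1)),
      x ≠ 0 ∧ x ∈ Metric.ball 0 1 := by
  have : Nontrivial (EuclideanSpace ℝ (Fin n)) := by
    have : Nonempty (Fin n) := ⟨⟨0, by omega⟩⟩
    infer_instance
  filter_upwards [ae_restrict_mem measurableSet_ball,
    ae_restrict_of_ae (compl_mem_ae_iff.2 (measure_singleton (0 : EuclideanSpace ℝ (Fin n))))]
    with x hx hx0 using ⟨hx0, hx⟩

lemma ae_of_forall_ball {p : EuclideanSpace ℝ (Fin n) → Prop}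
    (h : ∀ x ∈ Metric.ball (0 : EuclideanSpace ℝ (Fin n)) 1, p x) :
    ∀ᵐ x ∂(volume.restrict (Metric.ball (0 : EuclideanSpace ℝ (Fin n)) 1)), p x :=
  (ae_restrict_mem measurableSet_ball).mono h

lemma integrableOn_solution (hn : 2 ≤ n) (i : Fin n) :
    IntegrableOn (solution i) (Metric.ball 0 1) :=
  (integrable_majorant hn).integrableOn.mono' (measurable_solution i).aestronglyMeasurable
    (ae_of_forall_ball fun _ hx => abs_solution_le_majorant hn i hx)

lemma integrableOn_solutionGrad (hn : 2 ≤ n) (i : Fin n) :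
    IntegrableOn (solutionGrad i) (Metric.ball 0 1) :=
  ((integrable_majorant hn).const_mul _).integrableOn.mono'
    (measurable_solutionGrad i).aestronglyMeasurable
    (ae_of_forall_ball fun _ hx => norm_solutionGrad_le hn i hx)

lemma integrableOn_flux (hn : 2 ≤ n) (i : Fin n) :
    IntegrableOn (flux i) (Metric.ball 0 1) :=
  ((integrable_majorant hn).const_mul _).integrableOn.mono'
    (measurable_flux i).aestronglyMeasurable
    (ae_of_forall_ball fun _ hx => norm_flux_le hn i hx)

/-- The smooth compactly supported approximations of the solution. -/
noncomputable def approx (i : Fin n) (k : ℕ) (x : EuclideanSpace ℝ (Fin n)) : ℝ :=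
  cutoff puncturedDefining k x * solution i x

lemma isTestFunction_approx (i : Fin n) (k : ℕ) :
    IsTestFunction (Metric.ball 0 1) ⊤ (approx i k) := by
  have hsub : tsupport (approx i k) ⊆ Metric.ball 0 1 := fun x hx =>
    (puncturedDefining_pos_iff.1 (tsupport_cutoff_subset
      (contDiff_puncturedDefining (m := 0)).continuous k (tsupport_mul_subset_left hx))).2
  refine ⟨contDiff_cutoff_mul contDiff_puncturedDefining
    (fun x hx => contDiffAt_solution i (puncturedDefining_pos_iff.1 hx).1) k, ?_, hsub⟩
  exact (isCompact_closedBall (0 : EuclideanSpace ℝ (Fin n)) 1).of_isClosed_subset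
    (isClosed_tsupport _) (hsub.trans Metric.ball_subset_closedBall)

lemma gradient_approx (i : Fin n) (k : ℕ) {x : EuclideanSpace ℝ (Fin n)} (hx0 : x ≠ 0) :
    ∇ (approx i k) x = cutoff puncturedDefining k x • solutionGrad i x +
      solution i x • ∇ (cutoff puncturedDefining k) x :=
  ((hasGradientAt_cutoff (hasGradientAt_puncturedDefining x) k).differentiableAt.hasGradientAt.mul_real
    (hasGradientAt_solution i hx0)).gradient

lemma tendsto_integral_approx (hn : 2 ≤ n) (i : Fin n) :
    Tendsto (fun k => ∫ x in Metric.ball 0 1, |approx i k x - solution i x|) atTop (𝓝 0) := by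
  have h := tendsto_integral_of_dominated_convergence
    (μ := volume.restrict (Metric.ball (0 : EuclideanSpace ℝ (Fin n)) 1))
    (F := fun k x => |approx i k x - solution i x|) (f := fun _ => 0) majorant
    (fun k => ((((isTestFunction_approx i k).1.continuous.measurable).sub
      (measurable_solution i)).abs).aestronglyMeasurable)
    (integrable_majorant hn).integrableOn (fun k => ae_of_forall_ball fun x hx => ?_) ?_
  · simpa using h
  · rw [norm_abs_eq_norm, Real.norm_eq_abs, approx, ← sub_one_mul, abs_mul]
    refine (mul_le_of_le_one_left (abs_nonneg _) ?_).trans (abs_solution_le_majorant hn i hx)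
    rw [abs_le]
    constructor <;> linarith [cutoff_nonneg (puncturedDefining (n := n)) k x,
      cutoff_le_one (puncturedDefining (n := n)) k x]
  · filter_upwards [ae_mem_ball_ne_zero hn] with x hx
    refine tendsto_const_nhds.congr' ?_
    filter_upwards [eventually_cutoff_eq_one (hasGradientAt_puncturedDefining x)
      (puncturedDefining_pos_iff.2 hx)] with k hk
    simp [approx, hk.1]

lemma tendsto_integral_gradient_approx (hn : 2 ≤ n) (i : Fin n) :
    Tendsto (fun k => ∫ x in Metric.ball 0 1, ‖∇ (approx i k) x - solutionGrad i x‖)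
      atTop (𝓝 0) := by
  obtain ⟨C, hC0, hC⟩ := exists_norm_gradient_cutoff_le (F := EuclideanSpace ℝ (Fin n))
  have h := tendsto_integral_of_dominated_convergence
    (μ := volume.restrict (Metric.ball (0 : EuclideanSpace ℝ (Fin n)) 1))
    (F := fun k x => ‖∇ (approx i k) x - solutionGrad i x‖) (f := fun _ => 0)
    (fun x => (2 * n + 1 + C * n) * majorant x)
    (fun k => (((((isTestFunction_approx i k).contDiff_one le_top).continuous_gradient.measurable).sub
      (measurable_solutionGrad i)).norm).aestronglyMeasurable)
    ((integrable_majorant hn).const_mul _).integrableOn (fun k => ?_) ?_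
  · simpa using h
  · filter_upwards [ae_mem_ball_ne_zero hn] with x hx
    have h1 := norm_solutionGrad_le hn i hx.2
    have h2 := hC _ k x _ (hasGradientAt_puncturedDefining x) (puncturedDefining_pos_iff.2 hx)
    have h3 := abs_solution_mul_le hn i hx.1 hx.2
    have h4 : |cutoff (puncturedDefining (n := n)) k x - 1| ≤ 1 := by
      rw [abs_le]
      constructor <;> linarith [cutoff_nonneg (puncturedDefining (n := n)) k x,
        cutoff_le_one (puncturedDefining (n := n)) k x]
    -- The difference is regrouped as (ζ - 1)∇u + u∇ζ, and each term is dominated separately.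
    rw [norm_norm, gradient_approx i k hx.1, add_sub_right_comm]
    nth_rw 2 [← one_smul ℝ (solutionGrad i x)]
    rw [← sub_smul]
    refine (norm_add_le _ _).trans ?_
    rw [norm_smul, norm_smul, Real.norm_eq_abs, Real.norm_eq_abs]
    have h5 := mul_le_mul h4 h1 (norm_nonneg _) zero_le_one
    have h6 := mul_le_mul_of_nonneg_left h2 (abs_nonneg (solution i x))
    have h7 := mul_le_mul_of_nonneg_left h3 hC0
    linarith
  · filter_upwards [ae_mem_ball_ne_zero hn] with x hx
    refine tendsto_const_nhds.congr' ?_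
    filter_upwards [eventually_cutoff_eq_one (hasGradientAt_puncturedDefining x)
      (puncturedDefining_pos_iff.2 hx)] with k hk
    simp [gradient_approx i k hx.1, hk.1, hk.2]

lemma hasWeakGradient_solution (hn : 2 ≤ n) (i : Fin n) :
    HasWeakGradient (Metric.ball 0 1) (solution i) (solutionGrad i) :=
  hasWeakGradient_of_tendsto (integrableOn_solution hn i) (integrableOn_solutionGrad hn i)
    (isTestFunction_approx i) (tendsto_integral_approx hn i)
    (tendsto_integral_gradient_approx hn i)

lemma memW11Zero_solution (hn : 2 ≤ n) (i : Fin n) :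
    MemW11Zero (Metric.ball 0 1) (solution i) :=
  ⟨solutionGrad i, hasWeakGradient_solution hn i, integrableOn_solution hn i,
    integrableOn_solutionGrad hn i, approx i, isTestFunction_approx i,
    tendsto_integral_approx hn i, tendsto_integral_gradient_approx hn i⟩

/-! ### The equation -/

/-- The cutoff functions around the origin. -/
noncomputable def originCutoff (k : ℕ) : EuclideanSpace ℝ (Fin n) → ℝ :=
  cutoff (fun x => ‖x‖ ^ 2) k

lemma contDiff_originCutoff {m : ℕ∞} (k : ℕ) : ContDiff ℝ m (originCutoff (n := n) k) :=
  contDiff_cutoff (contDiff_norm_sq ℝ) k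

lemma gradient_originCutoff_neg (k : ℕ) (x : EuclideanSpace ℝ (Fin n)) :
    ∇ (originCutoff k) (-x) = -∇ (originCutoff k) x := by
  rw [originCutoff, (hasGradientAt_cutoff (hasGradientAt_norm_sq x) k).gradient,
    (hasGradientAt_cutoff (hasGradientAt_norm_sq (-x)) k).gradient]
  simp

/-- The flux is even and the gradient of a radial cutoff function is odd. -/
lemma integral_inner_flux_gradient_originCutoff (i : Fin n) (k : ℕ) :
    ∫ x in Metric.ball 0 1, inner ℝ (flux i x) (∇ (originCutoff k) x) = 0 := by
  set f : EuclideanSpace ℝ (Fin n) → ℝ := (Metric.ball 0 1).indicator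
    fun x => inner ℝ (flux i x) (∇ (originCutoff k) x) with hf
  have hodd : ∀ x, f (-x) = -f x := fun x => by
    by_cases hx : x ∈ Metric.ball (0 : EuclideanSpace ℝ (Fin n)) 1
    · have hx' : -x ∈ Metric.ball (0 : EuclideanSpace ℝ (Fin n)) 1 := by
        rw [mem_ball_zero_iff] at hx ⊢; rwa [norm_neg]
      rw [hf, indicator_of_mem hx, indicator_of_mem hx', flux_neg, gradient_originCutoff_neg,
        inner_neg_right]
    · have hx' : -x ∉ Metric.ball (0 : EuclideanSpace ℝ (Fin n)) 1 := by
        rw [mem_ball_zero_iff] at hx ⊢; rwa [norm_neg]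
      rw [hf, indicator_of_notMem hx, indicator_of_notMem hx', neg_zero]
  rw [← integral_indicator measurableSet_ball]
  -- The reflection x ↦ -x preserves the volume, so the integral equals its own negative.
  have h := integral_neg_eq_self f volume
  simp only [hodd, integral_neg] at h
  linarith

/-- The support of ζφ avoids the origin, where alone the flux is singular, so the classical
divergence theorem applies. -/
lemma integral_inner_flux_gradient_cutoff_mul (hn : 2 ≤ n) (i : Fin n) (k : ℕ)
    {φ : EuclideanSpace ℝ (Fin n) → ℝ} (hφ : IsTestFunction (Metric.ball 0 1) 1 φ) :
    ∫ x in Metric.ball 0 1, inner ℝ (flux i x) (∇ (fun y => originCutoff k y * φ y) x) = 0 := by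
  have hz : ∀ x ∉ Metric.ball (0 : EuclideanSpace ℝ (Fin n)) 1,
      ∇ (fun y => originCutoff k y * φ y) x = 0 := fun x hx =>
    image_eq_zero_of_notMem_tsupport (f := fun x => ∇ (fun y => originCutoff k y * φ y) x)
      fun h => hx (hφ.2.2 (tsupport_mul_subset_right (tsupport_gradient_subset _ h)))
  have hne : ∀ x ∈ tsupport (fun y => originCutoff k y * φ y), x ≠ 0 := fun x hx => by
    have : 0 < ‖x‖ ^ 2 := tsupport_cutoff_subset (ρ := fun x : EuclideanSpace ℝ (Fin n) => ‖x‖ ^ 2)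
      (by fun_prop) k (tsupport_mul_subset_left hx)
    rintro rfl
    simp at this
  rw [setIntegral_eq_integral_of_forall_compl_eq_zero fun x hx => by rw [hz x hx, inner_zero_right]]
  exact integral_inner_gradient_eq_zero ((contDiff_originCutoff (m := 1) k).mul hφ.1)
    hφ.2.1.mul_left (fun x hx j => contDiffAt_flux i j (hne x hx))
    fun x hx => sum_gradient_flux hn i (hne x hx)

/-- The flux of the solution is divergence free in the sense of distributions. -/
theorem integral_inner_flux_gradient (hn : 2 ≤ n) (i : Fin n)
    {φ : EuclideanSpace ℝ (Fin n) → ℝ} (hφ : IsTestFunction (Metric.ball 0 1) 1 φ) :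
    ∫ x in Metric.ball 0 1, inner ℝ (flux i x) (∇ φ x) = 0 := by
  have hφ1 : ContDiff ℝ 1 φ := hφ.1
  obtain ⟨C, hC0, hC⟩ := exists_norm_gradient_cutoff_le (F := EuclideanSpace ℝ (Fin n))
  obtain ⟨L, hL⟩ := hφ1.lipschitzWith_of_hasCompactSupport hφ.2.1 (by norm_num)
  obtain ⟨M, hM⟩ := hφ1.continuous_gradient.bounded_above_of_compact_support
    (hφ.2.1.of_isClosed_subset (isClosed_tsupport _) (tsupport_gradient_subset φ))
  have hflux := integrableOn_flux hn i
  have hζc : ∀ k, Continuous fun x : EuclideanSpace ℝ (Fin n) => ∇ (originCutoff k) x :=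
    fun k => (contDiff_originCutoff (m := 1) k).continuous_gradient
  have hm1 : ∀ k, AEStronglyMeasurable (fun x => originCutoff k x * inner ℝ (flux i x) (∇ φ x))
      (volume.restrict (Metric.ball (0 : EuclideanSpace ℝ (Fin n)) 1)) := fun k =>
    (contDiff_originCutoff (m := 1) k).continuous.aestronglyMeasurable.mul
      (hflux.aestronglyMeasurable.inner hφ1.continuous_gradient.aestronglyMeasurable)
  have hm2 : ∀ k, AEStronglyMeasurable
      (fun x => (φ x - φ 0) * inner ℝ (flux i x) (∇ (originCutoff k) x))
      (volume.restrict (Metric.ball (0 : EuclideanSpace ℝ (Fin n)) 1)) := fun k =>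
    (hφ1.continuous.sub continuous_const).aestronglyMeasurable.mul
      (hflux.aestronglyMeasurable.inner (hζc k).aestronglyMeasurable)
  have hb1 : ∀ k x, ‖originCutoff k x * inner ℝ (flux i x) (∇ φ x)‖ ≤ M * ‖flux i x‖ := by
    intro k x
    rw [norm_mul, Real.norm_eq_abs, abs_of_nonneg (a := originCutoff k x) (cutoff_nonneg _ k x),
      mul_comm M]
    refine (mul_le_of_le_one_left (norm_nonneg _) (cutoff_le_one _ k x)).trans ?_
    exact (norm_inner_le_norm _ _).trans (mul_le_mul_of_nonneg_left (hM x) (norm_nonneg _))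
  -- Uniform in k: the Lipschitz bound on φ - φ(0) gains a factor ‖x‖, which cancels the 1/‖x‖ of
  -- the cutoff gradient.
  have hb2 : ∀ k x, ‖(φ x - φ 0) * inner ℝ (flux i x) (∇ (originCutoff k) x)‖ ≤
      2 * L * C * ‖flux i x‖ := by
    intro k x
    rcases eq_or_ne x 0 with rfl | hx0
    · simp [flux_zero]
    have hr : 0 < ‖x‖ := norm_pos_iff.2 hx0
    have h1 : ‖φ x - φ 0‖ ≤ L * ‖x‖ := by simpa using hL.norm_sub_le x 0
    have h2 : ‖∇ (originCutoff k) x‖ ≤ C * (2 / ‖x‖) := by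
      refine (hC _ k x _ (hasGradientAt_norm_sq x) (normSq_pos hx0)).trans_eq ?_
      rw [norm_smul, Real.norm_eq_abs, abs_two]
      field_simp
    rw [norm_mul]
    calc ‖φ x - φ 0‖ * ‖inner ℝ (flux i x) (∇ (originCutoff k) x)‖
        ≤ (L * ‖x‖) * (‖flux i x‖ * (C * (2 / ‖x‖))) := by
          gcongr
          exact (norm_inner_le_norm _ _).trans (mul_le_mul_of_nonneg_left h2 (norm_nonneg _))
      _ = 2 * L * C * ‖flux i x‖ := by field_simp
  have hi1 : ∀ k, IntegrableOn (fun x => originCutoff k x * inner ℝ (flux i x) (∇ φ x))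
      (Metric.ball 0 1) := fun k =>
    (hflux.norm.const_mul M).mono' (hm1 k) (Eventually.of_forall (hb1 k))
  have hi2 : ∀ k, IntegrableOn (fun x => (φ x - φ 0) * inner ℝ (flux i x) (∇ (originCutoff k) x))
      (Metric.ball 0 1) := fun k =>
    (hflux.norm.const_mul _).mono' (hm2 k) (Eventually.of_forall (hb2 k))
  -- Integrability for each fixed k is enough, with a bound depending on k, since this term will
  -- vanish exactly by parity.
  have hi3 : ∀ k, IntegrableOn (fun x => inner ℝ (flux i x) (∇ (originCutoff k) x))
      (Metric.ball 0 1) := fun k => by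
    obtain ⟨K, hK⟩ := (isCompact_closedBall (0 : EuclideanSpace ℝ (Fin n)) 1).exists_bound_of_continuousOn
      (hζc k).continuousOn
    refine (hflux.norm.const_mul K).mono'
      (hflux.aestronglyMeasurable.inner (hζc k).aestronglyMeasurable)
      (ae_of_forall_ball fun x hx => ?_)
    rw [mul_comm K]
    exact (norm_inner_le_norm _ _).trans
      (mul_le_mul_of_nonneg_left (hK x (Metric.ball_subset_closedBall hx)) (norm_nonneg _))
  have hsplit : ∀ k, ∫ x in Metric.ball 0 1, originCutoff k x * inner ℝ (flux i x) (∇ φ x) =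
      -∫ x in Metric.ball 0 1, (φ x - φ 0) * inner ℝ (flux i x) (∇ (originCutoff k) x) := by
    intro k
    have h := integral_inner_flux_gradient_cutoff_mul hn i k hφ
    -- Product rule with φ = (φ - φ(0)) + φ(0) in the term that contains the gradient of the cutoff.
    have e : ∀ x, inner ℝ (flux i x) (∇ (fun y => originCutoff k y * φ y) x) =
        originCutoff k x * inner ℝ (flux i x) (∇ φ x) +
        (φ x - φ 0) * inner ℝ (flux i x) (∇ (originCutoff k) x) +
        φ 0 * inner ℝ (flux i x) (∇ (originCutoff k) x) := fun x => by
      rw [(((contDiff_originCutoff (m := 1) k).differentiable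
        (by norm_num) x).hasGradientAt.mul_real
        (hφ1.differentiable (by norm_num) x).hasGradientAt).gradient, inner_add_right,
        inner_smul_right, inner_smul_right]
      ring
    have hi12 : IntegrableOn (fun x => originCutoff k x * inner ℝ (flux i x) (∇ φ x) +
      (φ x - φ 0) * inner ℝ (flux i x) (∇ (originCutoff k) x)) (Metric.ball 0 1) :=
      (hi1 k).add (hi2 k)
    simp only [e] at h
    rw [integral_add hi12 ((hi3 k).const_mul _), integral_add (hi1 k) (hi2 k),
      integral_const_mul, integral_inner_flux_gradient_originCutoff] at h
    linarith
  have hev : ∀ x : EuclideanSpace ℝ (Fin n), x ≠ 0 →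
      ∀ᶠ k in atTop, originCutoff k x = 1 ∧ ∇ (originCutoff k) x = 0 := fun x hx0 =>
    eventually_cutoff_eq_one (hasGradientAt_norm_sq x) (normSq_pos hx0)
  have hlim1 : Tendsto (fun k => ∫ x in Metric.ball 0 1,
      originCutoff k x * inner ℝ (flux i x) (∇ φ x)) atTop
      (𝓝 (∫ x in Metric.ball 0 1, inner ℝ (flux i x) (∇ φ x))) := by
    refine tendsto_integral_of_dominated_convergence _ hm1 (hflux.norm.const_mul M)
      (fun k => Eventually.of_forall (hb1 k)) ?_
    filter_upwards [ae_mem_ball_ne_zero hn] with x hx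
    refine tendsto_const_nhds.congr' ?_
    filter_upwards [hev x hx.1] with k hk
    rw [hk.1, one_mul]
  have hlim2 : Tendsto (fun k => ∫ x in Metric.ball 0 1,
      (φ x - φ 0) * inner ℝ (flux i x) (∇ (originCutoff k) x)) atTop
      (𝓝 (∫ _ in Metric.ball (0 : EuclideanSpace ℝ (Fin n)) 1, (0 : ℝ))) := by
    refine tendsto_integral_of_dominated_convergence _ hm2 (hflux.norm.const_mul (2 * L * C))
      (fun k => Eventually.of_forall (hb2 k)) ?_
    filter_upwards [ae_mem_ball_ne_zero hn] with x hx
    refine tendsto_const_nhds.congr' ?_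
    filter_upwards [hev x hx.1] with k hk
    rw [hk.2, inner_zero_right, mul_zero]
  rw [integral_zero] at hlim2
  simpa using tendsto_nhds_unique hlim1 (hlim2.neg.congr fun k => (hsplit k).symm)

lemma isWeakSolution_solution (hn : 2 ≤ n) (i : Fin n) :
    IsWeakSolution (Metric.ball 0 1) coeffMatrix (solution i) := by
  refine ⟨solutionGrad i, hasWeakGradient_solution hn i, fun φ hφ => ?_⟩
  rw [← integral_inner_flux_gradient hn i hφ]
  refine setIntegral_congr_fun measurableSet_ball fun x hx => ?_
  simp only [coeffMatrix_mulVec_solutionGrad hn i hx, PiLp.inner_apply, dotProduct]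
  simp [mul_comm]

lemma not_ae_solution_eq_zero (hn : 2 ≤ n) (i : Fin n) :
    ¬ (∀ᵐ x ∂(volume.restrict (Metric.ball (0 : EuclideanSpace ℝ (Fin n)) 1)),
      solution i x = 0) := by
  intro h
  rw [ae_restrict_iff' measurableSet_ball] at h
  -- Any point of the punctured ball off the hyperplane xᵢ = 0 would do. By continuity u is nonzero
  -- on a neighbourhood, which has positive measure.
  set p : EuclideanSpace ℝ (Fin n) := EuclideanSpace.single i (1 / 2) with hp
  have hnorm : ‖p‖ = 1 / 2 := by simp [hp]
  have hp0 : p ≠ 0 := norm_pos_iff.1 (by rw [hnorm]; norm_num)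
  have hpb : p ∈ Metric.ball (0 : EuclideanSpace ℝ (Fin n)) 1 := by
    rw [mem_ball_zero_iff, hnorm]; norm_num
  have hpos : solution i p ≠ 0 := by
    have hpi : p i = 1 / 2 := by simp [hp]
    rw [solution, hpi]
    exact mul_ne_zero (by norm_num)
      (profile_pos (by exact_mod_cast hn) (normSq_pos hp0) (normSq_lt_one hpb)).ne'
  have hnhds : {x | ¬ (x ∈ Metric.ball (0 : EuclideanSpace ℝ (Fin n)) 1 → solution i x = 0)} ∈
      𝓝 p := by
    filter_upwards [Metric.isOpen_ball.mem_nhds hpb,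
      (contDiffAt_solution (m := 0) i hp0).continuousAt.eventually_ne hpos] with x hx hx'
    exact fun h => hx' (h hx)
  exact (Measure.measure_pos_of_mem_nhds volume hnhds).ne' (ae_iff.1 h)

end RadialProfile

theorem proposition2 (n : ℕ) (hn : 2 ≤ n) :
    ∃ A : EuclideanSpace ℝ (Fin n) → Matrix (Fin n) (Fin n) ℝ,
      ContinuousOn A (Metric.ball 0 1) ∧ IsElliptic (Metric.ball 0 1) A ∧
      ∃ u : EuclideanSpace ℝ (Fin n) → ℝ,
        MemW11Zero (Metric.ball 0 1) u ∧
        IsWeakSolution (Metric.ball 0 1) A u ∧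
        ¬ (∀ᵐ x ∂(volume.restrict (Metric.ball (0 : EuclideanSpace ℝ (Fin n)) 1)), u x = 0) :=
  ⟨RadialProfile.coeffMatrix, RadialProfile.continuousOn_coeffMatrix hn,
    RadialProfile.isElliptic_coeffMatrix hn, RadialProfile.solution ⟨0, by omega⟩,
    RadialProfile.memW11Zero_solution hn _, RadialProfile.isWeakSolution_solution hn _,
    RadialProfile.not_ae_solution_eq_zero hn _⟩
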